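/- **Setting.** Fix a horizon $H$, a state space $\mathcal S$, an action space $\mathcal A$ (measurable spaces) and an initial state $s_1$. An MDP $M=(P,R)$ consists of transition kernels $P_h:\mathcal S\times\mathcal A\to\Delta(\mathcal S)$ and rewards $R_h:\mathcal S\times\mathcal A\to[0,1]$, $h=1,\dots,H$ (equivalently, the step may be regarded as part of the state). A policy $\pi$ selects $a_h=\pi_h(s_h)$; write $M(\cdot|\pi)$ for the law of the trajectory $o=(s_h,a_h,r_h)_{h\le H}$, $r_h=R_h(s_h,a_h)$, started at $s_1$, and $V_M(\pi)=\mathbb E_{o\sim M(\cdot|\pi)}[\sum_{h=1}^H r_h]$. Let $Q_h^\pi(s,a;M)$, $V_h^\pi(s;M)$ be the usual value functions. Let $\Pi$ be a finite set of policies and $\mathcal M$ a finite set of MDPs such that for every $M\in\mathcal M$: (i) under every policy $\sum_{h=1}^H r_h\le 1$ almost surely, and $Q_h^\pi(s,a;M)\le 1$ for all $\pi,h,s,a$; (ii) $\Pi$ contains an optimal policy $\pi_M$ of $M$ (optimal from every state at every step); write $Q^\star_h(\cdot;M)=Q^{\pi_M}_h(\cdot;M)$ and $V_h^\star(\cdot;M)=V_h^{\pi_M}(\cdot;M)$.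 Assume the linear $Q^\star/V^\star$ condition: there are features $\varphi_h:\mathcal S\times\mathcal A\to\mathbb R^d$, $\psi_h:\mathcal S\to\mathbb R^d$ and a finite set $\mathcal F\subset\mathbb R^d\times\mathbb R^d$ such that for every $M\in\mathcal M$ there is $(\theta,w)\in\mathcal F$ with $Q^\star_h(s,a;M)=\varphi_h(s,a)^\top\theta$ and $V^\star_h(s;M)=\psi_h(s)^\top w$ for all $h\le H$, $s$, $a$. Let $\Phi=\{\phi_{\theta,w}:(\theta,w)\in\mathcal F\}$ with $$\phi_{\theta,w}=\{(M,\pi_M): M\in\mathcal M,\ Q^\star_h(s,a;M)=\varphi_h(s,a)^\top\theta,\ V^\star_h(s;M)=\psi_h(s)^\top w\ \ \forall h\le H,s,a\},$$ and let $\bar{\mathcal M}(\Phi)=\bigcup_{\phi\in\Phi}\mathrm{co}\{M(\cdot|\cdot): M\in\mathcal M,\ \exists\pi,\ (M,\pi)\in\phi\}$ be the class of mixtures of models within a group (each regarded as a map $\Pi\to\Delta(\text{trajectories})$, the value $V_M(\pi)$ of a mixture again being the expected total reward). For a class $\mathcal N$ of such maps and $\eta>0$ let $$\mathsf{DEC}^{\mathrm{KL}}_\eta(\mathcal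 N)=\sup_{\bar M\in\mathrm{co}(\mathcal N)}\ \inf_{p\in\Delta(\Pi)}\ \sup_{M\in\mathcal N}\ \mathbb E_{\pi\sim p}\Big[\max_{\pi'\in\Pi}V_M(\pi')-V_M(\pi)-\tfrac1\eta\,\mathrm{KL}\big(M(\cdot|\pi),\bar M(\cdot|\pi)\big)\Big].$$ **Theorem.** For every $\eta>0$, $\ \mathsf{DEC}^{\mathrm{KL}}_\eta(\bar{\mathcal M}(\Phi))\le 4\eta dH^2$. -/

import Mathlib

open MeasureTheory ProbabilityTheory
open scoped NNReal ENNReal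

noncomputable section

namespace LinearQV

/-! ### Decision making problems and the decision-estimation coefficient

A model with policy class `Pol` and observation space `O` is a map `M : Pol → Measure O`, where
`M π` is the law of the observation when `π` is executed.  The reward of an observation `o` is
`rew o`, so the value of `π` in `M` is the expectation of `rew` under `M π`. -/

section DEC

variable {Pol O : Type*} [Fintype Pol] [MeasurableSpace O]

/-- The value `V_M(π)`: the expected reward of the policy `π` in the model `M`. -/
def value (rew : O → ℝ) (M : Pol → Measure O) (π : Pol) : ℝ :=
  ∫ o, rew o ∂(M π)

/-- `𝔼_{π ∼ p} [V_M(π_M) - V_M(π) - (1/η) KL(M(·|π), M̄(·|π))]`, where `V_M(π_M) = max_π V_M(π)`.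
It is extended-real valued, since the relative entropy may be `∞` (the value is then `-∞`, unless
`p` gives no mass to such policies). -/
def decPayoff (rew : O → ℝ) (η : ℝ) (Mbar M : Pol → Measure O) (p : Pol → ℝ) : EReal :=
  ((∑ π, p π * ((⨆ π', value rew M π') - value rew M π) : ℝ) : EReal) -
    ((∑ π, ENNReal.ofReal (p π / η) * InformationTheory.klDiv (M π) (Mbar π) : ℝ≥0∞) : EReal)

/-- The offset decision-estimation coefficient with relative entropy of a model class:
`sup_{M̄ ∈ co(𝓜)} inf_{p ∈ Δ(Pol)} sup_{M ∈ 𝓜}` of `decPayoff`. -/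
def decKL (rew : O → ℝ) (η : ℝ) (models : Set (Pol → Measure O)) : EReal :=
  ⨆ Mbar ∈ convexHull ℝ≥0 models, ⨅ p ∈ stdSimplex ℝ Pol, ⨆ M ∈ models,
    decPayoff rew η Mbar M p

/-- The `Φ`-aware convexification `⋃_{φ ∈ Φ} co {M ∈ 𝓜 | ∃ π, (M, π) ∈ φ}`.  Models are presented
by the elements of a type `𝓘` (for instance MDPs), with `law M` the model presented by `M`. -/
def convexification {𝓘 : Type*} (law : 𝓘 → Pol → Measure O) (models : Set 𝓘)
    (Φ : Set (Set (𝓘 × Pol))) : Set (Pol → Measure O) :=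
  ⋃ φ ∈ Φ, convexHull ℝ≥0 (law '' {M | M ∈ models ∧ ∃ π, (M, π) ∈ φ})

end DEC

/-! ### Finite-horizon Markov decision processes

Steps are numbered `0, …, H - 1`.  Transitions, rewards and policies may depend on the step;
equivalently, the step is part of the state.  Only the data of the steps `h < H` matters. -/

section MDPs

/-- A deterministic Markov policy. -/
structure Policy (S A : Type*) [MeasurableSpace S] [MeasurableSpace A] where
  act : ℕ → S → A
  measurable_act : ∀ h, Measurable (act h)

/-- The transition kernels and the `[0,1]`-valued reward functions of an MDP. -/
structure MDP (S A : Type*) [MeasurableSpace S] [MeasurableSpace A] where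
  P : ℕ → Kernel (S × A) S
  markov : ∀ h, IsMarkovKernel (P h)
  R : ℕ → S × A → ℝ
  measurable_R : ∀ h, Measurable (R h)
  R_mem : ∀ h x, R h x ∈ Set.Icc (0 : ℝ) 1

variable {S A : Type*} [MeasurableSpace S] [MeasurableSpace A]

/-- The transition kernel of step `h` under a policy. -/
def MDP.next (M : MDP S A) (π : Policy S A) (h : ℕ) : Kernel S S :=
  (M.P h).comap (fun s => (s, π.act h s)) (measurable_id.prodMk (π.measurable_act h))

/-- The expected reward collected by `π` in the `n` steps `h, …, h + n - 1` from state `s`. -/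
def MDP.rewardToGo (M : MDP S A) (π : Policy S A) : ℕ → ℕ → S → ℝ
  | 0, _, _ => 0
  | n + 1, h, s => M.R h (s, π.act h s) + ∫ s', M.rewardToGo π n (h + 1) s' ∂(M.next π h s)

/-- The value function `V_h^π(s)` with horizon `H`. -/
def MDP.V (M : MDP S A) (H : ℕ) (π : Policy S A) (h : ℕ) (s : S) : ℝ :=
  M.rewardToGo π (H - h) h s

/-- The action-value function `Q_h^π(s, a)` with horizon `H` (for `h < H`). -/
def MDP.Q (M : MDP S A) (H : ℕ) (π : Policy S A) (h : ℕ) (s : S) (a : A) : ℝ :=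
  M.R h (s, a) + ∫ s', M.V H π (h + 1) s' ∂(M.P h (s, a))

/-- `π` is an optimal policy: it maximizes the value at every step and state. -/
def MDP.IsOptimal (M : MDP S A) (H : ℕ) (π : Policy S A) : Prop :=
  ∀ (π' : Policy S A), ∀ h < H, ∀ s, M.V H π' h s ≤ M.V H π h s

/-- A trajectory `(s_h, a_h, r_h)_h` of `n` steps. -/
abbrev Traj (S A : Type*) (n : ℕ) : Type _ := Fin n → S × A × ℝ

/-- The total reward of a trajectory. -/
def totalReward {S A : Type*} {n : ℕ} (o : Traj S A n) : ℝ := ∑ h, (o h).2.2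

/-- The law of the trajectory of `n` steps that `π` generates from step `h`, as a kernel in the
state at step `h`. -/
def MDP.trajKernel (M : MDP S A) (π : Policy S A) : (n : ℕ) → ℕ → Kernel S (Traj S A n)
  | 0, _ => Kernel.deterministic (fun _ => Fin.elim0) measurable_const
  | n + 1, h =>
    (Kernel.id ×ₖ (M.trajKernel π n (h + 1) ∘ₖ M.next π h)).map
      (fun x => Fin.cons (x.1, π.act h x.1, M.R h (x.1, π.act h x.1)) x.2)

/-- The law of the full trajectory (the observation) from the initial state `s₁`. -/
def MDP.trajLaw (M : MDP S A) (H : ℕ) (s₁ : S) (π : Policy S A) : Measure (Traj S A H) :=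
  M.trajKernel π H 0 s₁

/-- Normalization of the rewards: for every policy the total reward of an episode is almost surely
at most one, and the action-value functions (at all states) are at most one. -/
def MDP.Normalized (M : MDP S A) (H : ℕ) (s₁ : S) : Prop :=
  (∀ π : Policy S A, ∀ᵐ o ∂(M.trajLaw H s₁ π), totalReward o ≤ 1) ∧
    ∀ π : Policy S A, ∀ h < H, ∀ s a, M.Q H π h s a ≤ 1

/-- Given that `π` is optimal in `M`: `Q*(s, a; M) = ⟨φ(s, a), θ⟩` and `V*(s; M) = ⟨ψ(s), w⟩`. -/
def MDP.HasParam (M : MDP S A) (H : ℕ) (π : Policy S A) {d : ℕ}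
    (φ : ℕ → S → A → EuclideanSpace ℝ (Fin d)) (ψ : ℕ → S → EuclideanSpace ℝ (Fin d))
    (f : EuclideanSpace ℝ (Fin d) × EuclideanSpace ℝ (Fin d)) : Prop :=
  ∀ h < H, ∀ s, (∀ a, M.Q H π h s a = inner ℝ (φ h s a) f.1) ∧ M.V H π h s = inner ℝ (ψ h s) f.2

/-- The group `φ_{θ,w}` of the pairs `(M, π_M)`, `M ∈ 𝓜`, with parameters `f = (θ, w)`. -/
def group (H : ℕ) {Pol : Finset (Policy S A)} (models : Set (MDP S A)) (opt : MDP S A → Pol)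
    {d : ℕ} (φ : ℕ → S → A → EuclideanSpace ℝ (Fin d)) (ψ : ℕ → S → EuclideanSpace ℝ (Fin d))
    (f : EuclideanSpace ℝ (Fin d) × EuclideanSpace ℝ (Fin d)) : Set (MDP S A × Pol) :=
  {x | x.1 ∈ models ∧ x.2 = opt x.1 ∧ x.1.HasParam H (opt x.1) φ ψ f}

end MDPs

end LinearQV

end

/-
By minimax it suffices to beat every finitely supported prior `ρ` on the mixtures within the groups,
and posterior sampling does so: draw an independent copy `g` of the model and play its optimal
policy. Under the prior mixture, the suboptimality of the policy of `g` telescopes into the Bellman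
errors of the value functions of `g`. At each step the Bellman error is a linear function of
`(θ, w, 1)`, so the expected errors of the value functions of `i` when the policy of `g` is played
form a matrix of rank at most `2 d + 1`, whose weighted trace is controlled by the sum of the
squares of its entries. Whatever the policy, the value functions of `i` have mean error zero under
model `i` itself, so by Pinsker's inequality each square is at most a multiple of the relative
entropy of model `i` to the mixture, and it remains to complete the square.
-/

namespace LinearQV

open InformationTheory

section RelativeEntropy

variable {Ω : Type*} {mΩ : MeasurableSpace Ω}

section

variable {μ ν κ : Measure Ω} [IsProbabilityMeasure μ] [IsProbabilityMeasure ν]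

-- Donsker–Varadhan: Gibbs' inequality for `μ` and the tilted measure `ν.tilted f`.
lemma integral_sub_log_integral_exp_le_klDiv (h : klDiv μ ν ≠ ∞) {f : Ω → ℝ}
    (hfμ : Integrable f μ) (hfν : Integrable (fun x => Real.exp (f x)) ν) :
    ∫ x, f x ∂μ - Real.log (∫ x, Real.exp (f x) ∂ν) ≤ (klDiv μ ν).toReal := by
  obtain ⟨hac, hint⟩ := klDiv_ne_top_iff.1 h
  have := isProbabilityMeasure_tilted hfν
  have gibbs := integral_llr_add_sub_measure_univ_nonneg
    (hac.trans (absolutelyContinuous_tilted hfν)) (integrable_llr_tilted_right hac hfμ hint hfν)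
  rw [integral_llr_tilted_right hac hfμ hfν hint] at gibbs
  rw [toReal_klDiv hac hint]
  simp only [probReal_univ] at gibbs ⊢
  linarith

lemma mul_integral_sub_integral_le_klDiv_add (h : klDiv μ ν ≠ ∞) {X : Ω → ℝ} {a b : ℝ}
    (hX : AEMeasurable X ν) (hab : ∀ᵐ ω ∂ν, X ω ∈ Set.Icc a b) (t : ℝ) :
    t * (∫ ω, X ω ∂μ - ∫ ω, X ω ∂ν) ≤
      (klDiv μ ν).toReal + ((b - a) / 2) ^ 2 * t ^ 2 / 2 := by
  have hac := (klDiv_ne_top_iff.1 h).1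
  have hXμ : Integrable X μ := .of_mem_Icc a b (hX.mono_ac hac) (hac hab)
  have hsub := hasSubgaussianMGF_of_mem_Icc hX hab
  have hexp := hsub.integrable_exp_mul t
  have hmgf : Real.log (∫ ω, Real.exp (t * (X ω - ∫ ω, X ω ∂ν)) ∂ν) ≤
      ((b - a) / 2) ^ 2 * t ^ 2 / 2 := by
    rw [Real.log_le_iff_le_exp (integral_exp_pos hexp)]
    simpa [mgf, div_pow] using hsub.mgf_le t
  have hdv := integral_sub_log_integral_exp_le_klDiv h
    (f := fun ω => t * (X ω - ∫ ω, X ω ∂ν)) ((hXμ.sub (integrable_const _)).const_mul t) hexp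
  rw [integral_const_mul, integral_sub hXμ (integrable_const _), integral_const, probReal_univ,
    one_smul] at hdv
  linarith

-- Pinsker's inequality: the bound above holds for every `t`, so its discriminant is nonpositive.
lemma sq_integral_sub_integral_le_klDiv (h : klDiv μ ν ≠ ∞) {X : Ω → ℝ} {a b : ℝ}
    (hX : AEMeasurable X ν) (hab : ∀ᵐ ω ∂ν, X ω ∈ Set.Icc a b) :
    (∫ ω, X ω ∂μ - ∫ ω, X ω ∂ν) ^ 2 ≤ (b - a) ^ 2 / 2 * (klDiv μ ν).toReal := by
  set D := ∫ ω, X ω ∂μ - ∫ ω, X ω ∂ν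
  have hdiscr := discrim_le_zero (a := ((b - a) / 2) ^ 2 / 2) (b := -D)
    (c := (klDiv μ ν).toReal) fun t => by
      linarith [mul_integral_sub_integral_le_klDiv_add h hX hab t]
  rw [discrim] at hdiscr
  linarith

lemma llr_ae_eq_sub [SigmaFinite κ] (hμν : μ ≪ ν) (hνκ : ν ≪ κ) :
    llr ν κ =ᵐ[μ] fun ω => llr μ κ ω - llr μ ν ω := by
  have hμκ := hμν.trans hνκ
  filter_upwards [hμκ (Measure.rnDeriv_mul_rnDeriv (κ := κ) hμν), Measure.rnDeriv_pos hμν,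
    hμν (Measure.rnDeriv_pos hνκ), hμν (μ.rnDeriv_lt_top ν), hμκ (ν.rnDeriv_lt_top κ)]
    with ω hmul hμpos hνpos hμtop hνtop
  simp only [llr, ← hmul, Pi.mul_apply, ENNReal.toReal_mul]
  rw [Real.log_mul (ENNReal.toReal_pos hμpos.ne' hμtop.ne).ne'
    (ENNReal.toReal_pos hνpos.ne' hνtop.ne).ne']
  ring

variable [IsProbabilityMeasure κ]

lemma integrable_llr_of_klDiv_ne_top (hμν : klDiv μ ν ≠ ∞) (hμκ : klDiv μ κ ≠ ∞) (hνκ : ν ≪ κ) :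
    Integrable (llr ν κ) μ :=
  ((klDiv_ne_top_iff.1 hμκ).2.sub (klDiv_ne_top_iff.1 hμν).2).congr
    (llr_ae_eq_sub (klDiv_ne_top_iff.1 hμν).1 hνκ).symm

lemma integral_llr_eq_klDiv_sub_klDiv (hμν : klDiv μ ν ≠ ∞) (hμκ : klDiv μ κ ≠ ∞) (hνκ : ν ≪ κ) :
    ∫ ω, llr ν κ ω ∂μ = (klDiv μ κ).toReal - (klDiv μ ν).toReal := by
  obtain ⟨hacν, hintν⟩ := klDiv_ne_top_iff.1 hμν
  obtain ⟨hacκ, hintκ⟩ := klDiv_ne_top_iff.1 hμκ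
  rw [integral_congr_ae (llr_ae_eq_sub hacν hνκ), integral_sub hintκ hintν,
    toReal_klDiv_of_measure_eq hacν (by simp), toReal_klDiv_of_measure_eq hacκ (by simp)]

end

lemma klDiv_ne_top_of_le {μ ν : Measure Ω} [IsFiniteMeasure μ] [IsFiniteMeasure ν] (h : μ ≤ ν) :
    klDiv μ ν ≠ ∞ := by
  have hac := Measure.absolutelyContinuous_of_le h
  refine klDiv_ne_top hac ((integrable_klFun_rnDeriv_iff hac).1 ?_)
  obtain ⟨C, hC⟩ := isCompact_Icc.exists_bound_of_continuousOn
    (continuous_klFun.continuousOn (s := Set.Icc 0 1))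
  refine .of_bound (measurable_klFun.comp
    (Measure.measurable_rnDeriv μ ν).ennreal_toReal).aestronglyMeasurable C ?_
  filter_upwards [Measure.rnDeriv_le_one_of_le h] with ω hω
  exact hC _ ⟨ENNReal.toReal_nonneg, ENNReal.toReal_mono ENNReal.one_ne_top hω⟩

lemma klDiv_ne_top_of_smul_le {μ ν : Measure Ω} [IsFiniteMeasure μ] [IsFiniteMeasure ν]
    {c : ℝ≥0} (hc : c ≠ 0) (h : c • μ ≤ ν) : klDiv μ ν ≠ ∞ := by
  have hac : μ ≪ ν := (Measure.absolutelyContinuous_smul (ENNReal.coe_ne_zero.2 hc)).trans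
    (Measure.absolutelyContinuous_of_le h)
  have hint := ((klDiv_ne_top_iff.1 (klDiv_ne_top_of_le h)).2).smul_measure_nnreal (c := c⁻¹)
  rw [smul_smul, inv_mul_cancel₀ hc, one_smul] at hint
  refine klDiv_ne_top hac ((hint.sub (integrable_const (Real.log c))).congr ?_)
  filter_upwards [llr_smul_nnreal_left hac c hc] with ω hω
  simp [hω]

section Mixture

variable {ι : Type*} [Fintype ι]

/-- The mixture of the measures `P i` with weights `ρ i`. -/
noncomputable def mixture (ρ : ι → ℝ≥0) (P : ι → Measure Ω) : Measure Ω := ∑ i, ρ i • P i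

variable {ρ : ι → ℝ≥0} {P : ι → Measure Ω}

lemma smul_le_mixture (i : ι) : ρ i • P i ≤ mixture ρ P :=
  Finset.single_le_sum (f := fun i => ρ i • P i) (fun _ _ => Measure.zero_le _) (Finset.mem_univ i)

lemma mixture_absolutelyContinuous {ν : Measure Ω} (h : ∀ i, P i ≪ ν) : mixture ρ P ≪ ν := by
  intro s hs
  simp [mixture, Measure.coe_finsetSum, fun i => h i hs]

lemma ae_mixture {p : Ω → Prop} (h : ∀ i, ∀ᵐ ω ∂P i, p ω) : ∀ᵐ ω ∂mixture ρ P, p ω := by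
  simp [ae_iff, mixture, Measure.coe_finsetSum, fun i => ae_iff.1 (h i)]

lemma integrable_mixture {f : Ω → ℝ} (hf : ∀ i, ρ i ≠ 0 → Integrable f (P i)) :
    Integrable f (mixture ρ P) := by
  refine integrable_finsetSum_measure.2 fun i _ => ?_
  obtain hi | hi := eq_or_ne (ρ i) 0
  · simp [hi]
  · exact (hf i hi).smul_measure_nnreal

lemma integral_mixture {f : Ω → ℝ} (hf : Integrable f (mixture ρ P)) :
    ∫ ω, f ω ∂mixture ρ P = ∑ i, ρ i * ∫ ω, f ω ∂P i := by
  rw [mixture, integral_finsetSum_measure (integrable_finsetSum_measure.1 hf)]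
  simp only [integral_smul_nnreal_measure, NNReal.smul_def, smul_eq_mul]

variable [∀ i, IsProbabilityMeasure (P i)]

lemma isProbabilityMeasure_mixture (hρ : ∑ i, ρ i = 1) : IsProbabilityMeasure (mixture ρ P) := by
  constructor
  simp only [mixture, Measure.coe_finsetSum, Finset.sum_apply, Measure.smul_apply, measure_univ,
    ENNReal.smul_def, smul_eq_mul, mul_one]
  exact_mod_cast hρ

lemma klDiv_mixture_ne_top (hρ : ∑ i, ρ i = 1) {i : ι} (hi : ρ i ≠ 0) :
    klDiv (P i) (mixture ρ P) ≠ ∞ :=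
  have := isProbabilityMeasure_mixture (P := P) hρ
  klDiv_ne_top_of_smul_le hi (smul_le_mixture i)

-- The difference of the two sides is the relative entropy of the mixture with respect to `ν`.
lemma sum_klDiv_mixture_le (hρ : ∑ i, ρ i = 1) {ν : Measure Ω} [IsProbabilityMeasure ν]
    (h : ∀ i, klDiv (P i) ν ≠ ∞) :
    ∑ i, ρ i * (klDiv (P i) (mixture ρ P)).toReal ≤ ∑ i, ρ i * (klDiv (P i) ν).toReal := by
  have := isProbabilityMeasure_mixture (P := P) hρ
  have hac : mixture ρ P ≪ ν := mixture_absolutelyContinuous fun i => (klDiv_ne_top_iff.1 (h i)).1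
  have hint : Integrable (llr (mixture ρ P) ν) (mixture ρ P) := integrable_mixture fun i hi =>
    integrable_llr_of_klDiv_ne_top (klDiv_mixture_ne_top hρ hi) (h i) hac
  have gibbs := integral_llr_add_sub_measure_univ_nonneg hac hint
  have hgap : ∀ i, (ρ i : ℝ) * ∫ ω, llr (mixture ρ P) ν ω ∂P i =
      ρ i * (klDiv (P i) ν).toReal - ρ i * (klDiv (P i) (mixture ρ P)).toReal := by
    intro i
    obtain hi | hi := eq_or_ne (ρ i) 0
    · simp [hi]
    · rw [integral_llr_eq_klDiv_sub_klDiv (klDiv_mixture_ne_top hρ hi) (h i) hac, mul_sub]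
  simp only [integral_mixture hint, hgap, Finset.sum_sub_distrib, probReal_univ] at gibbs
  linarith

lemma sum_sq_integral_sub_integral_mixture_le (hρ : ∑ i, ρ i = 1) {ν : Measure Ω}
    [IsProbabilityMeasure ν] (h : ∀ i, klDiv (P i) ν ≠ ∞) {X : ι → Ω → ℝ} {a b : ℝ}
    (hX : ∀ i, Measurable (X i)) (hab : ∀ i, ∀ᵐ ω ∂mixture ρ P, X i ω ∈ Set.Icc a b) :
    ∑ i, ρ i * (∫ ω, X i ω ∂P i - ∫ ω, X i ω ∂mixture ρ P) ^ 2 ≤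
      (b - a) ^ 2 / 2 * ∑ i, ρ i * (klDiv (P i) ν).toReal := by
  have := isProbabilityMeasure_mixture (P := P) hρ
  refine le_trans ?_ (mul_le_mul_of_nonneg_left (sum_klDiv_mixture_le hρ h) (by positivity))
  rw [Finset.mul_sum]
  refine Finset.sum_le_sum fun i _ => ?_
  obtain hi | hi := eq_or_ne (ρ i) 0
  · simp [hi]
  rw [mul_left_comm]
  exact mul_le_mul_of_nonneg_left (sq_integral_sub_integral_le_klDiv
    (klDiv_mixture_ne_top hρ hi) (hX i).aemeasurable (hab i)) (NNReal.coe_nonneg _)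

end Mixture

end RelativeEntropy

section TraceAndRank

variable {ι E : Type*} [Fintype ι] [NormedAddCommGroup E] [InnerProductSpace ℝ E]
    [FiniteDimensional ℝ E]

lemma sum_sq_norm_starProjection_eq_finrank (b : OrthonormalBasis ι ℝ E)
    (U : Submodule ℝ E) : ∑ i, ‖U.starProjection (b i)‖ ^ 2 = Module.finrank ℝ U := by
  have hU : LinearMap.IsProj U (U.starProjection : E →ₗ[ℝ] E) :=
    ⟨fun x => U.starProjection_apply_mem x, fun x hx => U.starProjection_eq_self_iff.2 hx⟩
  rw [← hU.trace, LinearMap.trace_eq_sum_inner _ b]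
  refine Finset.sum_congr rfl fun i _ => ?_
  rw [ContinuousLinearMap.coe_coe, ← real_inner_self_eq_norm_sq,
    U.inner_starProjection_left_eq_right,
    U.starProjection_eq_self_iff.2 (U.starProjection_apply_mem _)]

-- Cauchy–Schwarz, after inserting the projection onto the range in front of `T`.
lemma sq_trace_le_finrank_range_mul_sum_sq_norm
    (b : OrthonormalBasis ι ℝ E) (T : E →ₗ[ℝ] E) :
    (LinearMap.trace ℝ E T) ^ 2 ≤
      Module.finrank ℝ (LinearMap.range T) * ∑ i, ‖T (b i)‖ ^ 2 := by
  set U := LinearMap.range T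
  have hproj : ∀ i, inner ℝ (b i) (T (b i)) = inner ℝ (U.starProjection (b i)) (T (b i)) := by
    intro i
    rw [U.inner_starProjection_left_eq_right, U.starProjection_eq_self_iff.2 ⟨_, rfl⟩]
  calc (LinearMap.trace ℝ E T) ^ 2
      = (∑ i, inner ℝ (U.starProjection (b i)) (T (b i))) ^ 2 := by
        rw [LinearMap.trace_eq_sum_inner T b, Finset.sum_congr rfl fun i _ => hproj i]
    _ ≤ (∑ i, ‖U.starProjection (b i)‖ * ‖T (b i)‖) ^ 2 := by
        refine sq_le_sq.2 (((Finset.abs_sum_le_sum_abs _ _).trans ?_).trans (le_abs_self _))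
        exact Finset.sum_le_sum fun i _ => abs_real_inner_le_norm _ _
    _ ≤ (∑ i, ‖U.starProjection (b i)‖ ^ 2) * ∑ i, ‖T (b i)‖ ^ 2 :=
        Finset.sum_mul_sq_le_sq_mul_sq _ _ _
    _ = Module.finrank ℝ U * ∑ i, ‖T (b i)‖ ^ 2 := by
        rw [sum_sq_norm_starProjection_eq_finrank]

end TraceAndRank

-- This is the trace of the matrix `√(ρ i * ρ j) * ℓ i (w j)`, which factors through `E`.
lemma sq_sum_apply_le_finrank_mul_sum_sq {ι E : Type*} [Fintype ι] [AddCommGroup E] [Module ℝ E]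
    [FiniteDimensional ℝ E] (ρ : ι → ℝ≥0) (ℓ : ι → E →ₗ[ℝ] ℝ) (w : ι → E) :
    (∑ i, ρ i * ℓ i (w i)) ^ 2 ≤
      Module.finrank ℝ E * ∑ i, ρ i * ∑ j, ρ j * (ℓ i (w j)) ^ 2 := by
  classical
  let B : E →ₗ[ℝ] EuclideanSpace ℝ ι :=
    (WithLp.linearEquiv 2 ℝ (ι → ℝ)).symm.toLinearMap ∘ₗ LinearMap.pi fun i => √(ρ i) • ℓ i
  let C : EuclideanSpace ℝ ι →ₗ[ℝ] E :=
    (EuclideanSpace.basisFun ι ℝ).toBasis.constr ℝ fun j => √(ρ j) • w j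
  let b := EuclideanSpace.basisFun ι ℝ
  have hBC : ∀ j i, B (C (b j)) i = √(ρ j) * (√(ρ i) * ℓ i (w j)) := fun j i => by
    simp [B, C, b]
  have htrace : LinearMap.trace ℝ _ (B ∘ₗ C) = ∑ i, ρ i * ℓ i (w i) := by
    rw [LinearMap.trace_eq_sum_inner _ b]
    refine Finset.sum_congr rfl fun i _ => ?_
    rw [LinearMap.comp_apply, EuclideanSpace.basisFun_inner, hBC, ← mul_assoc,
      Real.mul_self_sqrt (NNReal.coe_nonneg _)]
  have hnorm : ∀ j, ‖(B ∘ₗ C) (b j)‖ ^ 2 = ρ j * ∑ i, ρ i * (ℓ i (w j)) ^ 2 := by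
    intro j
    rw [LinearMap.comp_apply, EuclideanSpace.real_norm_sq_eq, Finset.mul_sum]
    refine Finset.sum_congr rfl fun i _ => ?_
    rw [hBC, mul_pow, mul_pow, Real.sq_sqrt (NNReal.coe_nonneg _),
      Real.sq_sqrt (NNReal.coe_nonneg _)]
  have hrank : Module.finrank ℝ (LinearMap.range (B ∘ₗ C)) ≤ Module.finrank ℝ E :=
    (Submodule.finrank_mono (LinearMap.range_comp_le_range C B)).trans B.finrank_range_le
  calc (∑ i, ρ i * ℓ i (w i)) ^ 2
      ≤ Module.finrank ℝ (LinearMap.range (B ∘ₗ C)) * ∑ j, ‖(B ∘ₗ C) (b j)‖ ^ 2 := by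
        rw [← htrace]
        exact sq_trace_le_finrank_range_mul_sum_sq_norm b _
    _ ≤ Module.finrank ℝ E * ∑ j, ρ j * ∑ i, ρ i * (ℓ i (w j)) ^ 2 := by
        simp only [hnorm]
        gcongr
    _ = Module.finrank ℝ E * ∑ i, ρ i * ∑ j, ρ j * (ℓ i (w j)) ^ 2 := by
        simp only [Finset.mul_sum]
        rw [Finset.sum_comm]
        exact Finset.sum_congr rfl fun i _ => Finset.sum_congr rfl fun j _ => by ring

-- Sion's theorem exchanges `min` over the simplex and `sup` over `convexHull ℝ T`.
lemma exists_stdSimplex_forall_sum_mul_le {κ : Type*} [Fintype κ] [Nonempty κ] {T : Set (κ → ℝ)}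
    {C : ℝ} (h : ∀ v ∈ convexHull ℝ T, ∃ k, v k ≤ C) :
    ∃ q ∈ stdSimplex ℝ κ, ∀ v ∈ T, ∑ k, q k * v k ≤ C := by
  classical
  let f : (κ → ℝ) → (κ → ℝ) → EReal := fun q v => ((q ⬝ᵥ v : ℝ) : EReal)
  have hmono : Monotone Real.toEReal := EReal.coe_strictMono.monotone
  have hnonempty : (stdSimplex ℝ κ).Nonempty := ⟨_, stdSimplex.barycenter.2⟩
  have hcont_left : ∀ v, Continuous fun q => f q v := fun v =>
    continuous_coe_real_ereal.comp (by unfold dotProduct; fun_prop)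
  have hcont_right : ∀ q, Continuous (f q) := fun q =>
    continuous_coe_real_ereal.comp (by unfold dotProduct; fun_prop)
  have hconvex : ∀ v, QuasiconvexOn ℝ (stdSimplex ℝ κ) fun q => f q v := fun v =>
    QuasiconvexOn.monotone_comp (g := Real.toEReal) hmono
      (((dotProductBilin ℝ ℝ).flip v).convexOn (convex_stdSimplex ℝ κ)).quasiconvexOn
  have hconcave : ∀ q, QuasiconcaveOn ℝ (convexHull ℝ T) (f q) := fun q =>
    QuasiconcaveOn.monotone_comp (g := Real.toEReal) hmono
      ((dotProductBilin ℝ ℝ q).concaveOn (convex_convexHull ℝ T)).quasiconcaveOn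
  have hminimax : ⨅ q ∈ stdSimplex ℝ κ, ⨆ v ∈ convexHull ℝ T, f q v ≤ (C : EReal) := by
    rw [Sion.minimax' hnonempty (convex_stdSimplex ℝ κ) (isCompact_stdSimplex ℝ κ)
      (fun v _ => (hcont_left v).lowerSemicontinuous.lowerSemicontinuousOn _) (fun v _ => hconvex v)
      (convex_convexHull ℝ T)
      (fun q _ => (hcont_right q).upperSemicontinuous.upperSemicontinuousOn _)
      fun q _ => hconcave q]
    refine iSup₂_le fun v hv => ?_
    obtain ⟨k, hk⟩ := h v hv
    refine (iInf₂_le _ (single_mem_stdSimplex ℝ k)).trans (EReal.coe_le_coe_iff.2 ?_)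
    rwa [single_one_dotProduct]
  obtain ⟨q, hq, hmin⟩ := LowerSemicontinuousOn.exists_isMinOn hnonempty
    (isCompact_stdSimplex ℝ κ) (f := fun q => ⨆ v ∈ convexHull ℝ T, f q v)
    ((lowerSemicontinuous_biSup fun v _ =>
      (hcont_left v).lowerSemicontinuous).lowerSemicontinuousOn _)
  refine ⟨q, hq, fun v hv => EReal.coe_le_coe_iff.1 ?_⟩
  calc f q v ≤ ⨆ v ∈ convexHull ℝ T, f q v := le_biSup (f q) (subset_convexHull ℝ T hv)
    _ ≤ ⨅ q ∈ stdSimplex ℝ κ, ⨆ v ∈ convexHull ℝ T, f q v := le_iInf₂ hmin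
    _ ≤ C := hminimax

section DEC

universe u

variable {Pol : Type u} {O : Type*} [MeasurableSpace O] {rew : O → ℝ} {η : ℝ}
    {Mbar M : Pol → Measure O} {p : Pol → ℝ}

/-- The regret of `π` in the model `M`, offset by `1 / η` times its relative entropy to the
reference model `Mbar`: the integrand of `decPayoff`. An infinite relative entropy counts as zero
here, so this is meant for policies at which it is finite. -/
noncomputable def offsetRegret (rew : O → ℝ) (η : ℝ) (Mbar M : Pol → Measure O) (π : Pol) : ℝ :=
  (⨆ π', value rew M π') - value rew M π - (klDiv (M π) (Mbar π)).toReal / η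

lemma offsetRegret_le_of_value_mem_Icc (hη : 0 < η) {L : ℝ} [Nonempty Pol]
    (h : ∀ π, value rew M π ∈ Set.Icc 0 L) (π : Pol) :
    offsetRegret rew η Mbar M π ≤ L := by
  have hkl : 0 ≤ (klDiv (M π) (Mbar π)).toReal / η := div_nonneg ENNReal.toReal_nonneg hη.le
  have hsup : ⨆ π', value rew M π' ≤ L := ciSup_le fun π' => (h π').2
  unfold offsetRegret
  linarith [(h π).1]

lemma convex_isProbabilityMeasure :
    Convex ℝ≥0 {N : Pol → Measure O | ∀ π, IsProbabilityMeasure (N π)} := by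
  intro N₁ h₁ N₂ h₂ a b _ _ hab π
  have := h₁ π
  have := h₂ π
  constructor
  simp only [Pi.add_apply, Pi.smul_apply, Measure.add_apply, Measure.smul_apply, measure_univ,
    ENNReal.smul_def, smul_eq_mul, mul_one]
  exact_mod_cast hab

variable [Fintype Pol]

lemma decPayoff_eq_bot (hη : 0 < η) {π : Pol} (hπ : 0 < p π) (hkl : klDiv (M π) (Mbar π) = ∞) :
    decPayoff rew η Mbar M p = ⊥ := by
  have htop : ∑ π, ENNReal.ofReal (p π / η) * klDiv (M π) (Mbar π) = ∞ := by
    refine ENNReal.sum_eq_top.2 ⟨π, Finset.mem_univ _, ?_⟩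
    rw [hkl, ENNReal.mul_top (ENNReal.ofReal_pos.2 (div_pos hπ hη)).ne']
  rw [decPayoff, htop, EReal.coe_ennreal_top, EReal.sub_top]

lemma decPayoff_eq_sum_mul_offsetRegret (hη : 0 < η) (hp : ∀ π, 0 ≤ p π)
    (hkl : ∀ π, klDiv (M π) (Mbar π) ≠ ∞) :
    decPayoff rew η Mbar M p = ((∑ π, p π * offsetRegret rew η Mbar M π : ℝ) : EReal) := by
  have hterm : ∀ π, ENNReal.ofReal (p π / η) * klDiv (M π) (Mbar π) =
      ENNReal.ofReal (p π * ((klDiv (M π) (Mbar π)).toReal / η)) := fun π => by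
    rw [mul_div_left_comm, mul_comm, ENNReal.ofReal_mul ENNReal.toReal_nonneg,
      ENNReal.ofReal_toReal (hkl π)]
  have hnonneg : ∀ π, 0 ≤ p π * ((klDiv (M π) (Mbar π)).toReal / η) := fun π =>
    mul_nonneg (hp π) (div_nonneg ENNReal.toReal_nonneg hη.le)
  rw [decPayoff, Finset.sum_congr rfl fun π _ => hterm π,
    ← ENNReal.ofReal_sum_of_nonneg fun π _ => hnonneg π, EReal.coe_ennreal_ofReal,
    max_eq_left (Finset.sum_nonneg fun π _ => hnonneg π), ← EReal.coe_sub,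
    ← Finset.sum_sub_distrib]
  simp only [offsetRegret, ← mul_sub]

-- Full support of the mixed weights turns an infinite relative entropy into the payoff `⊥`.
lemma decPayoff_mix_barycenter_le [Nonempty Pol] (hη : 0 < η) {q : Pol → ℝ}
    (hq : q ∈ stdSimplex ℝ Pol) {C L : ℝ}
    (hC : (∀ π, klDiv (M π) (Mbar π) ≠ ∞) → ∑ π, q π * offsetRegret rew η Mbar M π ≤ C)
    (hL : ∀ π, offsetRegret rew η Mbar M π ≤ L) {δ : ℝ} (hδ : δ ∈ Set.Ioc 0 1) :
    decPayoff rew η Mbar M ((1 - δ) • q + δ • (stdSimplex.barycenter : stdSimplex ℝ Pol).1) ≤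
      (((1 - δ) * C + δ * L : ℝ) : EReal) := by
  set u : stdSimplex ℝ Pol := stdSimplex.barycenter
  have hpos : ∀ π, 0 < ((1 - δ) • q + δ • u.1) π := fun π =>
    add_pos_of_nonneg_of_pos (mul_nonneg (sub_nonneg.2 hδ.2) (hq.1 π))
      (mul_pos hδ.1 (inv_pos.2 (Nat.cast_pos.2 Fintype.card_pos)))
  by_cases hkl : ∀ π, klDiv (M π) (Mbar π) ≠ ∞
  · rw [decPayoff_eq_sum_mul_offsetRegret hη (fun π => (hpos π).le) hkl, EReal.coe_le_coe_iff]
    have hu : ∑ π, u.1 π * offsetRegret rew η Mbar M π ≤ L :=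
      calc ∑ π, u.1 π * offsetRegret rew η Mbar M π ≤ ∑ π, u.1 π * L :=
            Finset.sum_le_sum fun π _ => mul_le_mul_of_nonneg_left (hL π) (u.2.1 π)
        _ = L := by rw [← Finset.sum_mul, u.2.2, one_mul]
    simp only [Pi.add_apply, Pi.smul_apply, smul_eq_mul, add_mul, mul_assoc,
      Finset.sum_add_distrib, ← Finset.mul_sum]
    exact add_le_add (mul_le_mul_of_nonneg_left (hC hkl) (sub_nonneg.2 hδ.2))
      (mul_le_mul_of_nonneg_left hu hδ.1.le)
  · push Not at hkl
    obtain ⟨π, hπ⟩ := hkl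
    rw [decPayoff_eq_bot hη (hpos π) hπ]
    exact bot_le

lemma iInf_iSup_decPayoff_le [Nonempty Pol] (hη : 0 < η) {models : Set (Pol → Measure O)} {C L : ℝ}
    (hL : ∀ M ∈ models, ∀ π, offsetRegret rew η Mbar M π ≤ L)
    (hC : ∀ v ∈ convexHull ℝ (offsetRegret rew η Mbar ''
      {M | M ∈ models ∧ ∀ π, klDiv (M π) (Mbar π) ≠ ∞}), ∃ π, v π ≤ C) :
    ⨅ p ∈ stdSimplex ℝ Pol, ⨆ M ∈ models, decPayoff rew η Mbar M p ≤ (C : EReal) := by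
  obtain ⟨q, hq, hqC⟩ := exists_stdSimplex_forall_sum_mul_le hC
  have hbound : ∀ δ ∈ Set.Ioc (0 : ℝ) 1,
      ⨅ p ∈ stdSimplex ℝ Pol, ⨆ M ∈ models, decPayoff rew η Mbar M p ≤
        (((1 - δ) * C + δ * L : ℝ) : EReal) := fun δ hδ =>
    (iInf₂_le _ (convex_stdSimplex ℝ Pol hq stdSimplex.barycenter.2 (sub_nonneg.2 hδ.2) hδ.1.le
      (sub_add_cancel 1 δ))).trans <| iSup₂_le fun M hM =>
        decPayoff_mix_barycenter_le hη hq (fun hkl => hqC _ ⟨M, ⟨hM, hkl⟩, rfl⟩) (hL M hM) hδ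
  have hlim : Filter.Tendsto (fun δ : ℝ => (((1 - δ) * C + δ * L : ℝ) : EReal))
      (nhdsWithin 0 (Set.Ioi 0)) (nhds (C : EReal)) := by
    have hcont : Continuous fun δ : ℝ => (1 - δ) * C + δ * L := by fun_prop
    have hzero : (1 - 0) * C + 0 * L = C := by ring
    exact ((EReal.continuous_coe_iff.2 hcont).tendsto' 0 C (congrArg _ hzero)).mono_left
      nhdsWithin_le_nhds
  exact ge_of_tendsto hlim (Filter.mem_of_superset (Ioc_mem_nhdsGT one_pos) hbound)

-- Posterior sampling: against the prior `ρ` over the models `N i`, the learner draws `g` from `ρ`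
-- and plays `σ g`.
theorem decKL_le_of_posterior_sampling (hη : 0 < η) {models : Set (Pol → Measure O)} {C L : ℝ}
    (hprob : ∀ M ∈ models, ∀ π, IsProbabilityMeasure (M π))
    (hvalue : ∀ M ∈ models, ∀ π, value rew M π ∈ Set.Icc 0 L)
    (hsampling : ∀ Mbar : Pol → Measure O, (∀ π, IsProbabilityMeasure (Mbar π)) →
      ∀ {ι : Type u} [Fintype ι] {ρ : ι → ℝ≥0} {N : ι → Pol → Measure O}, ∑ i, ρ i = 1 →
        (∀ i, N i ∈ models) → (∀ i π, klDiv (N i π) (Mbar π) ≠ ∞) →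
          ∃ σ : ι → Pol, ∑ g, ρ g * ∑ i, ρ i * offsetRegret rew η Mbar (N i) (σ g) ≤ C) :
    decKL rew η models ≤ (C : EReal) := by
  refine iSup₂_le fun Mbar hMbar => ?_
  have hMbar_prob : ∀ π, IsProbabilityMeasure (Mbar π) :=
    convexHull_min hprob convex_isProbabilityMeasure hMbar
  obtain ⟨M₀, hM₀⟩ := convexHull_nonempty_iff.1 ⟨Mbar, hMbar⟩
  have : Nonempty Pol := by
    have := hprob M₀ hM₀
    obtain ⟨σ, -⟩ := hsampling M₀ this (ι := PUnit) (ρ := 1) (N := fun _ => M₀) (by simp)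
      (fun _ => hM₀) (by simp [klDiv_self])
    exact ⟨σ ⟨⟩⟩
  refine iInf_iSup_decPayoff_le hη
    (fun M hM => offsetRegret_le_of_value_mem_Icc hη (hvalue M hM)) fun v hv => ?_
  obtain ⟨ι, _, z, ρ, hz, -, hρpos, hρ, rfl⟩ := eq_pos_convex_span_of_mem_convexHull hv
  lift ρ to ι → ℝ≥0 using fun i => (hρpos i).le
  choose N hN hNz using fun i => hz ⟨i, rfl⟩
  replace hρ : ∑ i, ρ i = 1 := NNReal.eq (by simpa using hρ)
  obtain ⟨σ, hσ⟩ := hsampling Mbar hMbar_prob hρ (fun i => (hN i).1)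
    fun i => (hN i).2
  have hsum : ∑ g, ρ g * (∑ i, (ρ i : ℝ) • z i) (σ g) ≤ ∑ g, ρ g * C := by
    rw [← Finset.sum_mul, ← NNReal.coe_sum, hρ, NNReal.coe_one, one_mul]
    simpa [← hNz, Finset.sum_apply] using hσ
  obtain ⟨g₀, hg₀, -⟩ := Finset.exists_ne_zero_of_sum_ne_zero (hρ.trans_ne one_ne_zero)
  obtain ⟨g, -, hg⟩ := Finset.exists_le_of_sum_le ⟨g₀, hg₀⟩ hsum
  exact ⟨σ g, le_of_mul_le_mul_left hg (hρpos g)⟩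

end DEC

section LinearFamilies

variable {ι E Ω : Type*} [AddCommGroup E] [Module ℝ E] {mΩ : MeasurableSpace Ω}

/-- The parameters at which a linear family of functions is integrable. -/
def integrableSubmodule (μ : Measure Ω) (T : E →ₗ[ℝ] (Ω → ℝ)) : Submodule ℝ E where
  carrier := {x | Integrable (T x) μ}
  add_mem' {x y} hx hy := by
    rw [Set.mem_ofPred_eq, map_add]
    exact Integrable.add hx hy
  zero_mem' := by
    rw [Set.mem_ofPred_eq, map_zero]
    exact integrable_zero _ _ _
  smul_mem' c x hx := by
    rw [Set.mem_ofPred_eq, map_smul]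
    exact Integrable.smul c hx

lemma exists_linearMap_eq_integral (μ : Measure Ω) (T : E →ₗ[ℝ] (Ω → ℝ)) :
    ∃ ℓ : E →ₗ[ℝ] ℝ, ∀ x, Integrable (T x) μ → ℓ x = ∫ ω, T x ω ∂μ := by
  let f : integrableSubmodule μ T →ₗ[ℝ] ℝ :=
    { toFun := fun x => ∫ ω, T x ω ∂μ
      map_add' := fun x y => by
        simp only [Submodule.coe_add, map_add, Pi.add_apply]
        exact integral_add x.2 y.2
      map_smul' := fun c x => by
        simp only [Submodule.coe_smul, map_smul, Pi.smul_apply, RingHom.id_apply]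
        exact integral_smul c _ }
  obtain ⟨ℓ, hℓ⟩ := f.exists_extend
  exact ⟨ℓ, fun x hx => LinearMap.congr_fun hℓ ⟨x, hx⟩⟩

-- `P g i` is the law of the observation when the posterior sample is `g` and the true model is `i`.
-- Averaging out `i` decouples the two: what remains is the matrix of the integrals of `T (x i)`
-- against `mixture ρ (P g)`, which has rank at most `finrank ℝ E`.
lemma sq_sum_integral_mixture_le [Fintype ι] [FiniteDimensional ℝ E] {ρ : ι → ℝ≥0}
    (hρ : ∑ i, ρ i = 1) {P : ι → ι → Measure Ω} [∀ g i, IsProbabilityMeasure (P g i)]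
    {ν : ι → Measure Ω} [∀ g, IsProbabilityMeasure (ν g)] (hkl : ∀ g i, klDiv (P g i) (ν g) ≠ ∞)
    (T : E →ₗ[ℝ] (Ω → ℝ)) {x : ι → E} {a b : ℝ} (hmeas : ∀ i, Measurable (T (x i)))
    (hab : ∀ g i, ∀ᵐ ω ∂mixture ρ (P g), T (x i) ω ∈ Set.Icc a b)
    (hzero : ∀ g i, ∫ ω, T (x i) ω ∂P g i = 0) :
    (∑ g, ρ g * ∫ ω, T (x g) ω ∂mixture ρ (P g)) ^ 2 ≤
      Module.finrank ℝ E *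
        ((b - a) ^ 2 / 2 * ∑ g, ρ g * ∑ i, ρ i * (klDiv (P g i) (ν g)).toReal) := by
  choose ℓ hℓ using fun g => exists_linearMap_eq_integral (mixture ρ (P g)) T
  have := fun g => isProbabilityMeasure_mixture (P := P g) hρ
  have hℓx : ∀ g i, ℓ g (x i) = ∫ ω, T (x i) ω ∂mixture ρ (P g) := fun g i =>
    hℓ g _ (.of_mem_Icc a b (hmeas i).aemeasurable (hab g i))
  have hpinsker : ∀ g, ∑ i, ρ i * (ℓ g (x i)) ^ 2 ≤
      (b - a) ^ 2 / 2 * ∑ i, ρ i * (klDiv (P g i) (ν g)).toReal := fun g => by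
    simpa only [hℓx, hzero, zero_sub, neg_sq] using
      sum_sq_integral_sub_integral_mixture_le hρ (hkl g) (X := fun i => T (x i)) hmeas (hab g)
  calc (∑ g, ρ g * ∫ ω, T (x g) ω ∂mixture ρ (P g)) ^ 2
      = (∑ g, ρ g * ℓ g (x g)) ^ 2 := by simp only [hℓx]
    _ ≤ Module.finrank ℝ E * ∑ g, ρ g * ∑ i, ρ i * (ℓ g (x i)) ^ 2 :=
        sq_sum_apply_le_finrank_mul_sum_sq ρ ℓ x
    _ ≤ Module.finrank ℝ E *
          ∑ g, ρ g * ((b - a) ^ 2 / 2 * ∑ i, ρ i * (klDiv (P g i) (ν g)).toReal) := by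
        gcongr with g
        exact hpinsker g
    _ = _ := by
        rw [Finset.mul_sum (a := (b - a) ^ 2 / 2)]
        simp only [mul_left_comm]

end LinearFamilies

lemma sum_sub_div_le_of_sq_le {ι : Type*} [Fintype ι] {x : ι → ℝ} {c K η : ℝ} (hη : 0 < η)
    (hK : 0 ≤ K) (hc : 0 ≤ c) (hx : ∀ i, x i ^ 2 ≤ c * K) :
    ∑ i, x i - K / η ≤ η * Fintype.card ι ^ 2 * c / 4 := by
  set n : ℝ := (Fintype.card ι : ℝ)
  have hsq : (∑ i, x i) ^ 2 ≤ (η * n ^ 2 * c / 4 + K / η) ^ 2 :=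
    calc (∑ i, x i) ^ 2 ≤ n * ∑ i, x i ^ 2 := sq_sum_le_card_mul_sum_sq
      _ ≤ n * (n * (c * K)) := by
          gcongr
          exact (Finset.sum_le_sum fun i _ => hx i).trans_eq (by simp [n])
      _ = 4 * (η * n ^ 2 * c / 4) * (K / η) := by field_simp
      _ ≤ (η * n ^ 2 * c / 4 + K / η) ^ 2 := four_mul_le_sq_add _ _
  linarith [le_of_sq_le_sq hsq (by positivity)]

section Trajectories

variable {S A : Type*} {n : ℕ}

/-- The function `V i` of the state at step `i` of a trajectory, and zero once the trajectory has
ended. -/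
noncomputable def valueAt (V : ℕ → S → ℝ) (i : ℕ) (o : Traj S A n) : ℝ :=
  if hi : i < n then V i (o ⟨i, hi⟩).1 else 0

lemma valueAt_fin (V : ℕ → S → ℝ) (i : Fin n) (o : Traj S A n) : valueAt V i o = V i (o i).1 :=
  dif_pos i.2

lemma valueAt_length (V : ℕ → S → ℝ) (o : Traj S A n) : valueAt V n o = 0 :=
  dif_neg n.lt_irrefl

lemma valueAt_cons (V : ℕ → S → ℝ) (i : ℕ) (x : S × A × ℝ) (o : Traj S A n) :
    valueAt V (i + 1) (Fin.cons x o : Traj S A (n + 1)) = valueAt (fun k => V (k + 1)) i o := by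
  by_cases hi : i < n
  · rw [valueAt, valueAt, dif_pos (Nat.succ_lt_succ hi), dif_pos hi]
    rfl
  · rw [valueAt, valueAt, dif_neg (by omega), dif_neg hi]

lemma valueAt_mem {B : Set ℝ} (hB : 0 ∈ B) {V : ℕ → S → ℝ} (hV : ∀ h s, V h s ∈ B) (i : ℕ)
    (o : Traj S A n) : valueAt V i o ∈ B := by
  unfold valueAt
  split_ifs
  exacts [hV _ _, hB]

variable [MeasurableSpace S] [MeasurableSpace A]

lemma measurable_cons (x : S × A × ℝ) :
    Measurable fun o : Traj S A n => (Fin.cons x o : Traj S A (n + 1)) := by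
  refine measurable_pi_iff.2 fun i => ?_
  cases i using Fin.cases with
  | zero => simp only [Fin.cons_zero, measurable_const]
  | succ i =>
    simp only [Fin.cons_succ]
    fun_prop

lemma measurable_valueAt {V : ℕ → S → ℝ} (hV : ∀ h, Measurable (V h)) (i : ℕ) :
    Measurable (valueAt V i : Traj S A n → ℝ) := by
  unfold valueAt
  split_ifs with hi
  · exact (hV i).comp (by fun_prop)
  · exact measurable_const

lemma integrable_valueAt {μ : Measure (Traj S A n)} [IsFiniteMeasure μ] {V : ℕ → S → ℝ}
    (hV : ∀ h, Measurable (V h)) {C : ℝ} (hC : ∀ h s, ‖V h s‖ ≤ C) (i : ℕ) :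
    Integrable (valueAt V i) μ := by
  by_cases hi : i < n
  · refine .of_bound (measurable_valueAt hV i).aestronglyMeasurable C (.of_forall fun o => ?_)
    rw [valueAt, dif_pos hi]
    exact hC _ _
  · have hzero : (valueAt V i : Traj S A n → ℝ) = 0 := funext fun o => dif_neg hi
    rw [hzero]
    exact integrable_zero _ _ _

lemma integrable_integral_kernel {μ : Measure (Traj S A n)} [IsFiniteMeasure μ] {V : S → ℝ}
    (hV : Measurable V) {C : ℝ} (hC : ∀ s, ‖V s‖ ≤ C) (P : Kernel (S × A) S) [IsMarkovKernel P]
    (i : Fin n) : Integrable (fun o => ∫ s', V s' ∂P ((o i).1, (o i).2.1)) μ := by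
  have hmeas : Measurable fun x => ∫ s', V s' ∂P x :=
    (hV.stronglyMeasurable.integral_kernel (κ := P)).measurable
  have hstep : Measurable fun o : Traj S A n => ((o i).1, (o i).2.1) := by fun_prop
  refine .of_bound (hmeas.comp hstep).aestronglyMeasurable C (.of_forall fun o => ?_)
  exact (norm_integral_le_of_norm_le_const (.of_forall hC)).trans_eq (by simp)

/-- The state, action and reward at step `h` of a trajectory of `π` that is in state `s`. -/
def MDP.step (M : MDP S A) (π : Policy S A) (h : ℕ) (s : S) : S × A × ℝ :=
  (s, π.act h s, M.R h (s, π.act h s))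

variable (M : MDP S A) (π : Policy S A)

instance MDP.isMarkovKernel_next (h : ℕ) : IsMarkovKernel (M.next π h) := by
  have := M.markov h
  unfold MDP.next
  infer_instance

lemma MDP.measurable_step (h : ℕ) : Measurable (M.step π h) := by
  have hact := π.measurable_act h
  have hR := M.measurable_R h
  unfold MDP.step
  fun_prop

lemma MDP.measurable_cons_step (n h : ℕ) :
    Measurable fun x : S × Traj S A n => (Fin.cons (M.step π h x.1) x.2 : Traj S A (n + 1)) := by
  refine measurable_pi_iff.2 fun i => ?_
  cases i using Fin.cases with
  | zero =>
    simp only [Fin.cons_zero]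
    exact (M.measurable_step π h).comp measurable_fst
  | succ i =>
    simp only [Fin.cons_succ]
    fun_prop

instance MDP.isMarkovKernel_trajKernel (n h : ℕ) : IsMarkovKernel (M.trajKernel π n h) := by
  induction n generalizing h with
  | zero =>
    unfold MDP.trajKernel
    infer_instance
  | succ n ih =>
    unfold MDP.trajKernel
    have := ih (h + 1)
    exact Kernel.IsMarkovKernel.map _ (M.measurable_cons_step π n h)

lemma MDP.trajKernel_succ_apply (n h : ℕ) (s : S) :
    M.trajKernel π (n + 1) h s =
      ((M.trajKernel π n (h + 1) ∘ₖ M.next π h) s).map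
        fun o => Fin.cons (M.step π h s) o := by
  have hcons := M.measurable_cons_step π n h
  unfold MDP.step at hcons
  rw [MDP.trajKernel, Kernel.map_apply _ hcons, Kernel.prod_apply,
    Kernel.id_apply, Measure.dirac_prod, Measure.map_map hcons measurable_prodMk_left]
  rfl

lemma MDP.integral_trajKernel_succ {n h : ℕ} {s : S} {F : Traj S A (n + 1) → ℝ}
    (hF : Integrable F (M.trajKernel π (n + 1) h s)) :
    ∫ o, F o ∂(M.trajKernel π (n + 1) h s) =
      ∫ s', ∫ o, F (Fin.cons (M.step π h s) o) ∂(M.trajKernel π n (h + 1) s')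
        ∂(M.next π h s) := by
  rw [M.trajKernel_succ_apply] at hF ⊢
  rw [integral_map (measurable_cons _).aemeasurable hF.1, Kernel.integral_comp]
  exact hF.comp_measurable (measurable_cons _)

lemma MDP.ae_trajKernel {B : ℕ → Set (S × A × ℝ)} (hB : ∀ h, MeasurableSet (B h)) {n h : ℕ} {s : S}
    (hinit : M.step π h s ∈ B h) (hstep : ∀ k > h, ∀ s', M.step π k s' ∈ B k) :
    ∀ᵐ o ∂(M.trajKernel π n h s), ∀ i : Fin n, o i ∈ B (h + i) := by
  induction n generalizing h s with
  | zero => exact .of_forall fun o i => i.elim0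
  | succ n ih =>
    have hmeas : ∀ m k, MeasurableSet {o : Traj S A m | ∀ i : Fin m, o i ∈ B (k + i)} := by
      intro m k
      simp only [Set.ofPred_forall]
      exact .iInter fun i => measurable_pi_apply i (hB _)
    have htail : ∀ᵐ o ∂((M.trajKernel π n (h + 1) ∘ₖ M.next π h) s),
        ∀ i : Fin n, o i ∈ B (h + 1 + i) :=
      Kernel.ae_comp_of_ae_ae (hmeas _ _) <| .of_forall fun s' =>
        ih (hstep _ h.lt_succ_self s') fun k hk => hstep k (by omega)
    rw [M.trajKernel_succ_apply, ae_map_iff (measurable_cons _).aemeasurable (hmeas _ _)]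
    filter_upwards [htail] with o ho i
    cases i using Fin.cases with
    | zero => simpa using hinit
    | succ i =>
      rw [Fin.cons_succ, Fin.val_succ, add_comm (i : ℕ), ← add_assoc]
      exact ho i

lemma MDP.integral_valueAt_zero {V : ℕ → S → ℝ} (hV : ∀ h, Measurable (V h)) {C : ℝ}
    (hC : ∀ h s, ‖V h s‖ ≤ C) {n : ℕ} (hend : ∀ s, V n s = 0) (h : ℕ) (s : S) :
    ∫ o, valueAt V 0 o ∂(M.trajKernel π n h s) = V 0 s := by
  cases n with
  | zero => simp [valueAt, hend]
  | succ n =>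
    rw [M.integral_trajKernel_succ π (integrable_valueAt hV hC 0)]
    simp [valueAt, MDP.step]

-- The Markov property at step `i`. The index of `V` counts the steps from `h`.
lemma MDP.integral_valueAt_succ {V : ℕ → S → ℝ} (hV : ∀ h, Measurable (V h)) {C : ℝ}
    (hC : ∀ h s, ‖V h s‖ ≤ C) {n : ℕ} (hend : ∀ s, V n s = 0) (h : ℕ) (s : S) (i : Fin n) :
    ∫ o, valueAt V (i + 1) o ∂(M.trajKernel π n h s) =
      ∫ o, (∫ s', V (i + 1) s' ∂(M.P (h + i) ((o i).1, (o i).2.1)))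
        ∂(M.trajKernel π n h s) := by
  induction n generalizing V h s with
  | zero => exact i.elim0
  | succ n ih =>
    have := M.markov (h + i)
    rw [M.integral_trajKernel_succ π (integrable_valueAt hV hC _),
      M.integral_trajKernel_succ π (integrable_integral_kernel (hV _) (hC _) _ i)]
    cases i using Fin.cases with
    | zero =>
      simp only [valueAt_cons, Fin.val_zero, Fin.cons_zero, integral_const, probReal_univ, one_smul,
        M.integral_valueAt_zero π (fun k => hV (k + 1)) (fun k => hC (k + 1)) hend]
      rfl
    | succ i =>
      simp only [valueAt_cons, Fin.val_succ, Fin.cons_succ, add_comm (i : ℕ) 1, ← add_assoc h]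
      exact integral_congr_ae <| .of_forall fun s' => by
        simpa only [add_comm] using
          ih (fun k => hV (k + 1)) (fun k => hC (k + 1)) hend (h + 1) s' i

end Trajectories

section Consistency

variable {S A : Type*} {H : ℕ}

/-- The Bellman error of `(Q, V)` at step `i` of a trajectory. -/
noncomputable def bellmanError (Q : ℕ → S → A → ℝ) (V : ℕ → S → ℝ) (i : Fin H)
    (o : Traj S A H) : ℝ :=
  Q i (o i).1 (o i).2.1 - (o i).2.2 - valueAt V (i + 1) o

lemma sum_bellmanError (Q : ℕ → S → A → ℝ) (V : ℕ → S → ℝ) (o : Traj S A H) :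
    ∑ i, bellmanError Q V i o =
      valueAt V 0 o - totalReward o + ∑ i : Fin H, (Q i (o i).1 (o i).2.1 - V i (o i).1) := by
  have htelescope : ∑ i : Fin H, (valueAt V i o - valueAt V (i + 1) o) = valueAt V 0 o := by
    rw [Fin.sum_univ_eq_sum_range fun i => valueAt V i o - valueAt V (i + 1) o,
      Finset.sum_range_sub', valueAt_length, sub_zero]
  rw [totalReward, ← htelescope, ← Finset.sum_sub_distrib, ← Finset.sum_add_distrib]
  refine Finset.sum_congr rfl fun i _ => ?_
  rw [bellmanError, valueAt_fin]
  ring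

variable [MeasurableSpace S] [MeasurableSpace A] {s₁ : S} {π : Policy S A} {Q : ℕ → S → A → ℝ}
    {V : ℕ → S → ℝ} {μ : Measure (Traj S A H)}

/-- The properties of a pair of optimal value functions that do not depend on the MDP: it is
measurable with values in `[0,1]`, `V` vanishes at the horizon and dominates `Q` before it. -/
structure IsValuePair (H : ℕ) (Q : ℕ → S → A → ℝ) (V : ℕ → S → ℝ) : Prop where
  measurable_Q : ∀ h, Measurable fun x : S × A => Q h x.1 x.2
  measurable_V : ∀ h, Measurable (V h)
  Q_nonneg : ∀ h s a, 0 ≤ Q h s a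
  Q_le_V : ∀ h < H, ∀ s a, Q h s a ≤ V h s
  V_mem : ∀ h s, V h s ∈ Set.Icc 0 1
  V_horizon : ∀ s, V H s = 0

/-- The actions of `π` maximize `Q`, of which `V` is the maximum. -/
def IsGreedy (H : ℕ) (π : Policy S A) (Q : ℕ → S → A → ℝ) (V : ℕ → S → ℝ) : Prop :=
  ∀ h < H, ∀ s, Q h s (π.act h s) = V h s

/-- The almost sure properties of the trajectories of `π` from `s₁` that hold in every MDP: they
start at `s₁`, take the actions of `π`, and collect rewards in `[0,1]`. Expressed through
measurable sets `B h`, since equality of states need not be measurable. -/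
structure IsTrajectoryLaw (s₁ : S) (π : Policy S A) (μ : Measure (Traj S A H)) : Prop where
  isProbabilityMeasure : IsProbabilityMeasure μ
  ae_mem : ∀ B : ℕ → Set (S × A × ℝ), (∀ h, MeasurableSet (B h)) →
    (∀ h s, ∀ r ∈ Set.Icc (0 : ℝ) 1, (h = 0 → s = s₁) → (s, π.act h s, r) ∈ B h) →
      ∀ᵐ o ∂μ, ∀ i : Fin H, o i ∈ B i

/-- The trajectories of `π` have law `μ`, and satisfy the Bellman equations of `(Q, V)` on average.
Unlike the Bellman equations themselves, this is preserved by mixtures. -/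
structure IsConsistent (s₁ : S) (Q : ℕ → S → A → ℝ) (V : ℕ → S → ℝ) (π : Policy S A)
    (μ : Measure (Traj S A H)) : Prop extends IsTrajectoryLaw s₁ π μ where
  integral_bellmanError : ∀ i : Fin H, ∫ o, bellmanError Q V i o ∂μ = 0

lemma IsValuePair.Q_mem (hQV : IsValuePair H Q V) {h : ℕ} (hh : h < H) (s : S) (a : A) :
    Q h s a ∈ Set.Icc 0 1 :=
  ⟨hQV.Q_nonneg h s a, (hQV.Q_le_V h hh s a).trans (hQV.V_mem h s).2⟩

lemma IsValuePair.measurable_bellmanError (hQV : IsValuePair H Q V) (i : Fin H) :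
    Measurable (bellmanError Q V i) := by
  have hQ : Measurable fun o : Traj S A H => Q i (o i).1 (o i).2.1 :=
    (hQV.measurable_Q i).comp (f := fun o : Traj S A H => ((o i).1, (o i).2.1)) (by fun_prop)
  have hr : Measurable fun o : Traj S A H => (o i).2.2 := by fun_prop
  exact (hQ.sub hr).sub (measurable_valueAt hQV.measurable_V (i + 1))

namespace IsTrajectoryLaw

lemma ae_reward_mem (hμ : IsTrajectoryLaw s₁ π μ) : ∀ᵐ o ∂μ, ∀ i, (o i).2.2 ∈ Set.Icc (0 : ℝ) 1 :=
  hμ.ae_mem (fun _ => {x | x.2.2 ∈ Set.Icc 0 1})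
    (fun _ => (measurable_snd.comp measurable_snd) measurableSet_Icc) fun _ _ _ hr _ => hr

lemma ae_totalReward_mem (hμ : IsTrajectoryLaw s₁ π μ) :
    ∀ᵐ o ∂μ, totalReward o ∈ Set.Icc (0 : ℝ) H := by
  filter_upwards [hμ.ae_reward_mem] with o ho
  exact ⟨Finset.sum_nonneg fun i _ => (ho i).1,
    (Finset.sum_le_sum fun i _ => (ho i).2).trans_eq (by simp)⟩

lemma integrable_totalReward (hμ : IsTrajectoryLaw s₁ π μ) : Integrable totalReward μ := by
  have := hμ.isProbabilityMeasure
  refine .of_mem_Icc 0 H (Measurable.aemeasurable ?_) hμ.ae_totalReward_mem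
  unfold totalReward
  fun_prop

lemma integral_totalReward_mem (hμ : IsTrajectoryLaw s₁ π μ) :
    ∫ o, totalReward o ∂μ ∈ Set.Icc (0 : ℝ) H := by
  have := hμ.isProbabilityMeasure
  exact (convex_Icc 0 (H : ℝ)).integral_mem isClosed_Icc hμ.ae_totalReward_mem
    hμ.integrable_totalReward

lemma ae_bellmanError_mem (hμ : IsTrajectoryLaw s₁ π μ) (hQV : IsValuePair H Q V) (i : Fin H) :
    ∀ᵐ o ∂μ, bellmanError Q V i o ∈ Set.Icc (-2 : ℝ) 1 := by
  filter_upwards [hμ.ae_reward_mem] with o ho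
  obtain ⟨hr₀, hr₁⟩ := ho i
  obtain ⟨hQ₀, hQ₁⟩ := hQV.Q_mem i.2 (o i).1 (o i).2.1
  obtain ⟨hV₀, hV₁⟩ := valueAt_mem (Set.left_mem_Icc.2 zero_le_one) hQV.V_mem (i + 1) o
  constructor <;> unfold bellmanError <;> linarith

lemma integrable_bellmanError (hμ : IsTrajectoryLaw s₁ π μ) (hQV : IsValuePair H Q V)
    (i : Fin H) : Integrable (bellmanError Q V i) μ :=
  have := hμ.isProbabilityMeasure
  .of_mem_Icc (-2) 1 (hQV.measurable_bellmanError i).aemeasurable (hμ.ae_bellmanError_mem hQV i)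

lemma ae_valueAt_zero (hμ : IsTrajectoryLaw s₁ π μ) (hQV : IsValuePair H Q V) :
    ∀ᵐ o ∂μ, valueAt V 0 o = V 0 s₁ := by
  have hae := hμ.ae_mem (fun h => {x | h = 0 → V h x.1 = V h s₁})
    (fun h => (MeasurableSet.const _).imp
      (measurableSet_eq_fun ((hQV.measurable_V h).comp measurable_fst) measurable_const))
    fun h s _ _ hs hh => congrArg (V h) (hs hh)
  filter_upwards [hae] with o ho
  obtain rfl | hH := H.eq_zero_or_pos
  · exact (dif_neg (lt_irrefl 0)).trans (hQV.V_horizon s₁).symm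
  · exact (valueAt_fin V ⟨0, hH⟩ o).trans (ho ⟨0, hH⟩ rfl)

lemma ae_Q_eq_V_of_isGreedy (hμ : IsTrajectoryLaw s₁ π μ) (hQV : IsValuePair H Q V)
    (hπ : IsGreedy H π Q V) : ∀ᵐ o ∂μ, ∀ i : Fin H, Q i (o i).1 (o i).2.1 = V i (o i).1 := by
  have hae := hμ.ae_mem (fun h => {x | h < H → Q h x.1 x.2.1 = V h x.1})
    (fun h => (MeasurableSet.const _).imp <| measurableSet_eq_fun
      ((hQV.measurable_Q h).comp (measurable_fst.prodMk (measurable_fst.comp measurable_snd)))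
      ((hQV.measurable_V h).comp measurable_fst))
    fun h s _ _ _ hh => hπ h hh s
  filter_upwards [hae] with o ho i using ho i i.2

lemma integral_valueAt_zero_sub_totalReward (hμ : IsTrajectoryLaw s₁ π μ)
    (hQV : IsValuePair H Q V) :
    ∫ o, (valueAt V 0 o - totalReward o) ∂μ = V 0 s₁ - ∫ o, totalReward o ∂μ := by
  have := hμ.isProbabilityMeasure
  have hinit : (fun o => valueAt V 0 o - totalReward o) =ᵐ[μ] fun o => V 0 s₁ - totalReward o := by
    filter_upwards [hμ.ae_valueAt_zero hQV] with o ho using by rw [ho]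
  rw [integral_congr_ae hinit, integral_sub (integrable_const _) hμ.integrable_totalReward,
    integral_const, probReal_univ, one_smul]

lemma integrable_valueAt_zero_sub_totalReward (hμ : IsTrajectoryLaw s₁ π μ)
    (hQV : IsValuePair H Q V) : Integrable (fun o => valueAt V 0 o - totalReward o) μ := by
  have := hμ.isProbabilityMeasure
  refine ((integrable_const (V 0 s₁)).sub hμ.integrable_totalReward).congr ?_
  filter_upwards [hμ.ae_valueAt_zero hQV] with o ho using by simp [ho]

lemma sub_integral_totalReward_eq_of_isGreedy (hμ : IsTrajectoryLaw s₁ π μ)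
    (hQV : IsValuePair H Q V) (hπ : IsGreedy H π Q V) :
    V 0 s₁ - ∫ o, totalReward o ∂μ = ∑ i, ∫ o, bellmanError Q V i o ∂μ := by
  rw [← hμ.integral_valueAt_zero_sub_totalReward hQV,
    ← integral_finsetSum _ fun i _ => hμ.integrable_bellmanError hQV i]
  refine integral_congr_ae ?_
  filter_upwards [hμ.ae_Q_eq_V_of_isGreedy hQV hπ] with o ho
  simp only [sum_bellmanError, ho, sub_self, Finset.sum_const_zero, add_zero]

end IsTrajectoryLaw

-- Since `Q ≤ V`, the Bellman errors sum to at most `valueAt V 0 o - totalReward o`.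
lemma IsConsistent.integral_totalReward_le (hμ : IsConsistent s₁ Q V π μ)
    (hQV : IsValuePair H Q V) : ∫ o, totalReward o ∂μ ≤ V 0 s₁ := by
  have hint := fun i => hμ.integrable_bellmanError hQV i
  rw [← sub_nonneg, ← hμ.integral_valueAt_zero_sub_totalReward hQV]
  calc 0 = ∑ i, ∫ o, bellmanError Q V i o ∂μ := by simp [hμ.integral_bellmanError]
    _ = ∫ o, ∑ i, bellmanError Q V i o ∂μ := (integral_finsetSum _ fun i _ => hint i).symm
    _ ≤ ∫ o, (valueAt V 0 o - totalReward o) ∂μ := by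
        refine integral_mono (integrable_finsetSum _ fun i _ => hint i)
          (hμ.integrable_valueAt_zero_sub_totalReward hQV) fun o => ?_
        rw [sum_bellmanError]
        exact add_le_of_nonpos_right (Finset.sum_nonpos fun i _ =>
          sub_nonpos.2 (hQV.Q_le_V i i.2 _ _))

section Mixture

variable {ι : Type*} [Fintype ι] {ρ : ι → ℝ≥0} {P : ι → Measure (Traj S A H)}

lemma IsTrajectoryLaw.mixture (hρ : ∑ i, ρ i = 1) (hP : ∀ i, IsTrajectoryLaw s₁ π (P i)) :
    IsTrajectoryLaw s₁ π (mixture ρ P) where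
  isProbabilityMeasure :=
    have := fun i => (hP i).isProbabilityMeasure
    isProbabilityMeasure_mixture hρ
  ae_mem B hB hmem := ae_mixture fun i => (hP i).ae_mem B hB hmem

lemma IsConsistent.mixture (hρ : ∑ i, ρ i = 1) (hQV : IsValuePair H Q V)
    (hP : ∀ i, IsConsistent s₁ Q V π (P i)) : IsConsistent s₁ Q V π (mixture ρ P) where
  toIsTrajectoryLaw := .mixture hρ fun i => (hP i).toIsTrajectoryLaw
  integral_bellmanError k := by
    rw [integral_mixture (integrable_mixture fun i _ => (hP i).integrable_bellmanError hQV k)]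
    simp [fun i => (hP i).integral_bellmanError k]

end Mixture

lemma convex_isConsistent {Pol : Type*} (policy : Pol → Policy S A) (hQV : IsValuePair H Q V) :
    Convex ℝ≥0 {N : Pol → Measure (Traj S A H) | ∀ p, IsConsistent s₁ Q V (policy p) (N p)} := by
  intro N₁ h₁ N₂ h₂ a b _ _ hab p
  have hmix : (a • N₁ + b • N₂) p = mixture ![a, b] ![N₁ p, N₂ p] := by
    simp [mixture, Fin.sum_univ_two]
  rw [hmix]
  refine .mixture (by simpa [Fin.sum_univ_two] using hab) hQV fun i => ?_
  fin_cases i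
  exacts [h₁ p, h₂ p]

lemma MDP.isTrajectoryLaw_trajLaw (M : MDP S A) (H : ℕ) (s₁ : S) (π : Policy S A) :
    IsTrajectoryLaw s₁ π (M.trajLaw H s₁ π) where
  isProbabilityMeasure := by
    unfold MDP.trajLaw
    infer_instance
  ae_mem B hB hmem := by
    simpa only [MDP.trajLaw, zero_add] using M.ae_trajKernel π hB (n := H)
      (hmem 0 s₁ _ (M.R_mem 0 _) fun _ => rfl)
      fun k hk s => hmem k s _ (M.R_mem k _) fun hk₀ => absurd hk₀ hk.ne'

lemma MDP.ae_reward_eq (M : MDP S A) (H : ℕ) (s₁ : S) (π : Policy S A) :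
    ∀ᵐ o ∂(M.trajLaw H s₁ π), ∀ i : Fin H, (o i).2.2 = M.R i ((o i).1, (o i).2.1) := by
  have hR := M.measurable_R
  simpa only [MDP.trajLaw, zero_add, Set.mem_ofPred_eq] using
    M.ae_trajKernel π (n := H) (h := 0) (s := s₁) (B := fun h => {x | x.2.2 = M.R h (x.1, x.2.1)})
    (fun h => measurableSet_eq_fun (by fun_prop) (by fun_prop)) rfl fun _ _ _ => rfl

lemma MDP.isConsistent_trajLaw (M : MDP S A) (s₁ : S) (π : Policy S A) (hQV : IsValuePair H Q V)
    (hbellman : ∀ h < H, ∀ s a, Q h s a = M.R h (s, a) + ∫ s', V (h + 1) s' ∂M.P h (s, a)) :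
    IsConsistent s₁ Q V π (M.trajLaw H s₁ π) where
  toIsTrajectoryLaw := M.isTrajectoryLaw_trajLaw H s₁ π
  integral_bellmanError i := by
    have := (M.isTrajectoryLaw_trajLaw H s₁ π).isProbabilityMeasure
    have := M.markov i
    have hV : ∀ h s, ‖V h s‖ ≤ 1 := fun h s => by
      rw [Real.norm_of_nonneg (hQV.V_mem h s).1]
      exact (hQV.V_mem h s).2
    have herror : bellmanError Q V i =ᵐ[M.trajLaw H s₁ π] fun o =>
        (∫ s', V (i + 1) s' ∂M.P i ((o i).1, (o i).2.1)) - valueAt V (i + 1) o := by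
      filter_upwards [M.ae_reward_eq H s₁ π] with o ho
      rw [bellmanError, hbellman i i.2, ho]
      ring
    have hmarkov := M.integral_valueAt_succ π hQV.measurable_V hV hQV.V_horizon 0 s₁ i
    rw [zero_add] at hmarkov
    rw [integral_congr_ae herror, integral_sub
      (integrable_integral_kernel (hQV.measurable_V _) (hV _) _ i)
      (integrable_valueAt hQV.measurable_V hV _), sub_eq_zero]
    exact hmarkov.symm

end Consistency

section PosteriorSampling

variable {S A E F : Type*} [NormedAddCommGroup E] [InnerProductSpace ℝ E] [NormedAddCommGroup F]
    [InnerProductSpace ℝ F] {H : ℕ}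

/-- The pair `(Q, V)` is linear in the features `φ` and `ψ`, with parameters `f = (θ, w)`:
`MDP.HasParam` for arbitrary functions and feature spaces. -/
def IsLinearPair (H : ℕ) (φ : ℕ → S → A → E) (ψ : ℕ → S → F) (f : E × F) (Q : ℕ → S → A → ℝ)
    (V : ℕ → S → ℝ) : Prop :=
  ∀ h < H, ∀ s, (∀ a, Q h s a = inner ℝ (φ h s a) f.1) ∧ V h s = inner ℝ (ψ h s) f.2

/-- The Bellman error at step `i` as a linear function of the parameter `(θ, w, 1)`. -/
noncomputable def linearBellmanError (φ : ℕ → S → A → E) (ψ : ℕ → S → F) (i : Fin H) :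
    E × F × ℝ →ₗ[ℝ] (Traj S A H → ℝ) where
  toFun x o := inner ℝ (φ i (o i).1 (o i).2.1) x.1 - x.2.2 * (o i).2.2 -
    valueAt (fun h s => inner ℝ (ψ h s) x.2.1) (i + 1) o
  map_add' x y := by
    funext o
    simp only [valueAt, Prod.fst_add, Prod.snd_add, inner_add_right, Pi.add_apply]
    split_ifs <;> ring
  map_smul' c x := by
    funext o
    simp only [valueAt, Prod.smul_fst, Prod.smul_snd, inner_smul_right, Pi.smul_apply,
      RingHom.id_apply, smul_eq_mul]
    split_ifs <;> ring

lemma IsLinearPair.linearBellmanError_eq {φ : ℕ → S → A → E} {ψ : ℕ → S → F} {f : E × F}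
    {Q : ℕ → S → A → ℝ} {V : ℕ → S → ℝ} (hf : IsLinearPair H φ ψ f Q V) (i : Fin H) :
    linearBellmanError φ ψ i (f.1, f.2, 1) = bellmanError Q V i := by
  funext o
  simp only [bellmanError, linearBellmanError, LinearMap.coe_mk, AddHom.coe_mk, valueAt, one_mul,
    (hf i i.2 _).1]
  split_ifs with hi
  · rw [(hf _ hi _).2]
  · rfl

variable [MeasurableSpace S] [MeasurableSpace A] {ι : Type*} [Fintype ι] {s₁ : S} {ρ : ι → ℝ≥0}
    {π : ι → Policy S A} {Q : ι → ℕ → S → A → ℝ} {V : ι → ℕ → S → ℝ}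
    {P : ι → ι → Measure (Traj S A H)}

-- Both sides average over `g` the suboptimality of `π g` in `mixture ρ (P g)`: the average of the
-- optimal values `V i 0 s₁` over the true model `i` is also their average over the sample `g`.
lemma sum_sub_integral_totalReward_eq (hρ : ∑ i, ρ i = 1) (hQV : ∀ i, IsValuePair H (Q i) (V i))
    (hπ : ∀ i, IsGreedy H (π i) (Q i) (V i)) (hP : ∀ g i, IsTrajectoryLaw s₁ (π g) (P g i)) :
    ∑ g, ρ g * ∑ i, ρ i * (V i 0 s₁ - ∫ o, totalReward o ∂P g i) =
      ∑ h, ∑ g, ρ g * ∫ o, bellmanError (Q g) (V g) h o ∂mixture ρ (P g) := by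
  have hρ' : ∑ i, (ρ i : ℝ) = 1 := by exact_mod_cast hρ
  have hmix : ∀ g, IsTrajectoryLaw s₁ (π g) (mixture ρ (P g)) := fun g => .mixture hρ (hP g)
  have hvalue : ∀ g, ∫ o, totalReward o ∂mixture ρ (P g) =
      ∑ i, ρ i * ∫ o, totalReward o ∂P g i := fun g =>
    integral_mixture (hmix g).integrable_totalReward
  calc ∑ g, ρ g * ∑ i, ρ i * (V i 0 s₁ - ∫ o, totalReward o ∂P g i)
      = ∑ g, ρ g * (V g 0 s₁ - ∫ o, totalReward o ∂mixture ρ (P g)) := by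
        simp only [hvalue, mul_sub, Finset.sum_sub_distrib, ← Finset.sum_mul, hρ', one_mul]
    _ = ∑ g, ρ g * ∑ h, ∫ o, bellmanError (Q g) (V g) h o ∂mixture ρ (P g) := by
        simp only [fun g => (hmix g).sub_integral_totalReward_eq_of_isGreedy (hQV g) (hπ g)]
    _ = ∑ h, ∑ g, ρ g * ∫ o, bellmanError (Q g) (V g) h o ∂mixture ρ (P g) := by
        simp only [Finset.mul_sum]
        exact Finset.sum_comm

variable {ν : ι → Measure (Traj S A H)} [∀ g, IsProbabilityMeasure (ν g)]

lemma sq_sum_integral_bellmanError_le [FiniteDimensional ℝ E] [FiniteDimensional ℝ F]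
    {φ : ℕ → S → A → E} {ψ : ℕ → S → F} {f : ι → E × F} (hρ : ∑ i, ρ i = 1)
    (hQV : ∀ i, IsValuePair H (Q i) (V i)) (hf : ∀ i, IsLinearPair H φ ψ (f i) (Q i) (V i))
    (hP : ∀ g i, IsConsistent s₁ (Q i) (V i) (π g) (P g i))
    (hkl : ∀ g i, klDiv (P g i) (ν g) ≠ ∞) (h : Fin H) :
    (∑ g, ρ g * ∫ o, bellmanError (Q g) (V g) h o ∂mixture ρ (P g)) ^ 2 ≤
      (Module.finrank ℝ E + Module.finrank ℝ F + 1) * (9 / 2) *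
        ∑ g, ρ g * ∑ i, ρ i * (klDiv (P g i) (ν g)).toReal := by
  have := fun g i => (hP g i).isProbabilityMeasure
  have hmix : ∀ g, IsTrajectoryLaw s₁ (π g) (mixture ρ (P g)) := fun g =>
    .mixture hρ fun i => (hP g i).toIsTrajectoryLaw
  have herror := fun i => (hf i).linearBellmanError_eq h
  have hsq := sq_sum_integral_mixture_le hρ hkl (linearBellmanError φ ψ h)
    (x := fun i => ((f i).1, (f i).2, 1)) (a := -2) (b := 1)
    (fun i => by simpa only [herror] using (hQV i).measurable_bellmanError h)
    (fun g i => by simpa only [herror] using (hmix g).ae_bellmanError_mem (hQV i) h)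
    (fun g i => by simpa only [herror] using (hP g i).integral_bellmanError h)
  simp only [herror] at hsq
  refine hsq.trans_eq ?_
  rw [Module.finrank_prod, Module.finrank_prod, Module.finrank_self]
  push_cast
  ring

lemma sum_suboptimality_sub_klDiv_le [FiniteDimensional ℝ E] [FiniteDimensional ℝ F]
    {φ : ℕ → S → A → E} {ψ : ℕ → S → F} {f : ι → E × F} (hρ : ∑ i, ρ i = 1)
    (hQV : ∀ i, IsValuePair H (Q i) (V i)) (hπ : ∀ i, IsGreedy H (π i) (Q i) (V i))
    (hf : ∀ i, IsLinearPair H φ ψ (f i) (Q i) (V i))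
    (hP : ∀ g i, IsConsistent s₁ (Q i) (V i) (π g) (P g i))
    (hkl : ∀ g i, klDiv (P g i) (ν g) ≠ ∞) {η : ℝ} (hη : 0 < η) :
    ∑ g, ρ g * ∑ i, ρ i *
        (V i 0 s₁ - ∫ o, totalReward o ∂P g i - (klDiv (P g i) (ν g)).toReal / η) ≤
      η * H ^ 2 * ((Module.finrank ℝ E + Module.finrank ℝ F + 1) * (9 / 2)) / 4 := by
  set K := ∑ g, ρ g * ∑ i, ρ i * (klDiv (P g i) (ν g)).toReal with hK
  have hK₀ : 0 ≤ K := by positivity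
  have hsplit : ∑ g, ρ g * ∑ i, ρ i *
        (V i 0 s₁ - ∫ o, totalReward o ∂P g i - (klDiv (P g i) (ν g)).toReal / η) =
      ∑ g, ρ g * ∑ i, ρ i * (V i 0 s₁ - ∫ o, totalReward o ∂P g i) - K / η := by
    simp only [hK, Finset.sum_div, mul_div_assoc, ← Finset.sum_sub_distrib, ← mul_sub]
  rw [hsplit, sum_sub_integral_totalReward_eq hρ hQV hπ fun g i => (hP g i).toIsTrajectoryLaw]
  exact (sum_sub_div_le_of_sq_le hη hK₀ (by positivity) fun h =>
    sq_sum_integral_bellmanError_le hρ hQV hf hP hkl h).trans_eq (by rw [Fintype.card_fin])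

lemma sum_suboptimality_sub_klDiv_le_four_mul {d : ℕ} {φ : ℕ → S → A → EuclideanSpace ℝ (Fin d)}
    {ψ : ℕ → S → EuclideanSpace ℝ (Fin d)}
    {f : ι → EuclideanSpace ℝ (Fin d) × EuclideanSpace ℝ (Fin d)} (hρ : ∑ i, ρ i = 1)
    (hQV : ∀ i, IsValuePair H (Q i) (V i)) (hπ : ∀ i, IsGreedy H (π i) (Q i) (V i))
    (hf : ∀ i, IsLinearPair H φ ψ (f i) (Q i) (V i))
    (hP : ∀ g i, IsConsistent s₁ (Q i) (V i) (π g) (P g i))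
    (hkl : ∀ g i, klDiv (P g i) (ν g) ≠ ∞) {η : ℝ} (hη : 0 < η) :
    ∑ g, ρ g * ∑ i, ρ i *
        (V i 0 s₁ - ∫ o, totalReward o ∂P g i - (klDiv (P g i) (ν g)).toReal / η) ≤
      4 * η * d * H ^ 2 := by
  obtain rfl | hd := d.eq_zero_or_pos
  · have hV : ∀ i, V i 0 s₁ = 0 := fun i => by
      obtain rfl | hH := H.eq_zero_or_pos
      · exact (hQV i).V_horizon s₁
      · rw [(hf i 0 hH s₁).2, Subsingleton.elim (f i).2 0, inner_zero_right]
    have hterm : ∀ g i,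
        V i 0 s₁ - ∫ o, totalReward o ∂P g i - (klDiv (P g i) (ν g)).toReal / η ≤ 0 := fun g i => by
      have hkl₀ : 0 ≤ (klDiv (P g i) (ν g)).toReal / η := by positivity
      linarith [hV i, (hP g i).integral_totalReward_mem.1]
    rw [Nat.cast_zero, mul_zero, zero_mul]
    exact Finset.sum_nonpos fun g _ => mul_nonpos_of_nonneg_of_nonpos (ρ g).coe_nonneg <|
      Finset.sum_nonpos fun i _ => mul_nonpos_of_nonneg_of_nonpos (ρ i).coe_nonneg (hterm g i)
  · have hd' : (1 : ℝ) ≤ d := by exact_mod_cast hd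
    calc _ ≤ η * H ^ 2 * (((d : ℝ) + d + 1) * (9 / 2)) / 4 := by
          simpa only [finrank_euclideanSpace_fin] using
            sum_suboptimality_sub_klDiv_le hρ hQV hπ hf hP hkl hη
      _ = η * H ^ 2 * ((2 * d + 1) * (9 / 8)) := by ring
      _ ≤ η * H ^ 2 * (4 * d) := mul_le_mul_of_nonneg_left (by linarith) (by positivity)
      _ = 4 * η * d * H ^ 2 := by ring

lemma offsetRegret_le_suboptimality_sub_klDiv {Pol : Type*} {policy : Pol → Policy S A}
    {Q : ℕ → S → A → ℝ} {V : ℕ → S → ℝ} {N Mbar : Pol → Measure (Traj S A H)}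
    (hQV : IsValuePair H Q V) (hN : ∀ p, IsConsistent s₁ Q V (policy p) (N p)) (η : ℝ) (p : Pol) :
    offsetRegret totalReward η Mbar N p ≤
      V 0 s₁ - ∫ o, totalReward o ∂N p - (klDiv (N p) (Mbar p)).toReal / η := by
  have : Nonempty Pol := ⟨p⟩
  have hsup : ⨆ p', value totalReward N p' ≤ V 0 s₁ :=
    ciSup_le fun p' => (hN p').integral_totalReward_le hQV
  unfold offsetRegret
  gcongr
  exact le_rfl

end PosteriorSampling

section ValueFunctions

variable {S A : Type*} [MeasurableSpace S] [MeasurableSpace A]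

namespace MDP

variable (M : MDP S A)

lemma measurable_rewardToGo (π : Policy S A) (n h : ℕ) : Measurable (M.rewardToGo π n h) := by
  induction n generalizing h with
  | zero => exact measurable_const
  | succ n ih =>
    exact ((M.measurable_R h).comp (measurable_id.prodMk (π.measurable_act h))).add
      ((ih (h + 1)).stronglyMeasurable.integral_kernel (κ := M.next π h)).measurable

lemma rewardToGo_nonneg (π : Policy S A) (n h : ℕ) (s : S) : 0 ≤ M.rewardToGo π n h s := by
  induction n generalizing h s with
  | zero => exact le_rfl
  | succ n ih => exact add_nonneg (M.R_mem h _).1 (integral_nonneg fun s' => ih (h + 1) s')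

lemma rewardToGo_congr {π π' : Policy S A} (n : ℕ) {h : ℕ}
    (hact : ∀ k, h ≤ k → π.act k = π'.act k) : M.rewardToGo π n h = M.rewardToGo π' n h := by
  induction n generalizing h with
  | zero => rfl
  | succ n ih =>
    have hnext : M.rewardToGo π n (h + 1) = M.rewardToGo π' n (h + 1) :=
      ih fun k hk => hact k (Nat.le_of_succ_le hk)
    funext s
    simp only [rewardToGo, next, Kernel.comap_apply, hact h le_rfl, hnext]

variable {H h : ℕ}

lemma V_eq_Q_act (hh : h < H) (π : Policy S A) (s : S) :
    M.V H π h s = M.Q H π h s (π.act h s) := by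
  obtain ⟨n, rfl⟩ := Nat.exists_eq_add_of_lt hh
  simp only [V, Q, show h + n + 1 - h = n + 1 by omega, show h + n + 1 - (h + 1) = n by omega,
    rewardToGo, next, Kernel.comap_apply]

lemma V_of_ge (hh : H ≤ h) (π : Policy S A) (s : S) : M.V H π h s = 0 := by
  rw [V, Nat.sub_eq_zero_of_le hh, rewardToGo]

lemma V_nonneg (H h : ℕ) (π : Policy S A) (s : S) : 0 ≤ M.V H π h s :=
  M.rewardToGo_nonneg π _ h s

lemma Q_nonneg (H h : ℕ) (π : Policy S A) (s : S) (a : A) : 0 ≤ M.Q H π h s a :=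
  add_nonneg (M.R_mem h _).1 (integral_nonneg fun s' => M.V_nonneg H _ π s')

lemma measurable_Q (H h : ℕ) (π : Policy S A) :
    Measurable fun x : S × A => M.Q H π h x.1 x.2 := by
  have := M.markov h
  exact (M.measurable_R h).add
    ((M.measurable_rewardToGo π _ _).stronglyMeasurable.integral_kernel (κ := M.P h)).measurable

end MDP

/-- The policy that plays the action `a` at step `h`, and follows `π` otherwise. -/
noncomputable def Policy.update (π : Policy S A) (h : ℕ) (a : A) : Policy S A where
  act := Function.update π.act h fun _ => a
  measurable_act k := by
    obtain rfl | hk := eq_or_ne k h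
    · simp only [Function.update_self, measurable_const]
    · simpa only [Function.update_of_ne hk] using π.measurable_act k

namespace MDP.IsOptimal

variable {M : MDP S A} {H : ℕ} {π : Policy S A}

lemma Q_le_V (hopt : M.IsOptimal H π) {h : ℕ} (hh : h < H) (s : S) (a : A) :
    M.Q H π h s a ≤ M.V H π h s := by
  have hact : (π.update h a).act h s = a := by simp only [Policy.update, Function.update_self]
  have hnext : M.V H (π.update h a) (h + 1) = M.V H π (h + 1) :=
    M.rewardToGo_congr _ fun k hk => Function.update_of_ne (Nat.ne_of_gt hk) _ _
  calc M.Q H π h s a = M.V H (π.update h a) h s := by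
        rw [M.V_eq_Q_act hh, hact, Q, Q, hnext]
    _ ≤ M.V H π h s := hopt _ h hh s

lemma isValuePair (hopt : M.IsOptimal H π) (hV : ∀ h < H, ∀ s, M.V H π h s ≤ 1) :
    IsValuePair H (M.Q H π) (M.V H π) where
  measurable_Q h := M.measurable_Q H h π
  measurable_V h := M.measurable_rewardToGo π _ h
  Q_nonneg h s a := M.Q_nonneg H h π s a
  Q_le_V h hh s a := hopt.Q_le_V hh s a
  V_mem h s := by
    refine ⟨M.V_nonneg H h π s, ?_⟩
    obtain hh | hh := lt_or_ge h H
    · exact hV h hh s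
    · exact (M.V_of_ge hh π s).trans_le zero_le_one
  V_horizon s := M.V_of_ge le_rfl π s

end MDP.IsOptimal

section Group

variable {H d : ℕ} {φ : ℕ → S → A → EuclideanSpace ℝ (Fin d)}
    {ψ : ℕ → S → EuclideanSpace ℝ (Fin d)}
    {f : EuclideanSpace ℝ (Fin d) × EuclideanSpace ℝ (Fin d)}

-- Models with the same parameters share their optimal value functions, hence Bellman equations.
lemma MDP.HasParam.isConsistent_trajLaw {M M₀ : MDP S A} {π π₀ : Policy S A}
    (hM : M.HasParam H π φ ψ f) (hM₀ : M₀.HasParam H π₀ φ ψ f)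
    (hQV : IsValuePair H (M₀.Q H π₀) (M₀.V H π₀)) (s₁ : S) (p : Policy S A) :
    IsConsistent s₁ (M₀.Q H π₀) (M₀.V H π₀) p (M.trajLaw H s₁ p) := by
  refine M.isConsistent_trajLaw s₁ p hQV fun h hh s a => ?_
  have hnext : M₀.V H π₀ (h + 1) = M.V H π (h + 1) := by
    funext s'
    obtain hh' | hh' := lt_or_ge (h + 1) H
    · rw [(hM₀ _ hh' s').2, (hM _ hh' s').2]
    · rw [M₀.V_of_ge hh', M.V_of_ge hh']
  rw [(hM₀ h hh s).1, ← (hM h hh s).1, MDP.Q, hnext]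

variable {s₁ : S} {Pol : Finset (Policy S A)} {models : Set (MDP S A)} {opt : MDP S A → Pol}
    {F : Set (EuclideanSpace ℝ (Fin d) × EuclideanSpace ℝ (Fin d))}

lemma exists_isConsistent_of_mem_convexification (hopt : ∀ M ∈ models, M.IsOptimal H (opt M))
    (hV : ∀ M ∈ models, ∀ h < H, ∀ s, M.V H (opt M) h s ≤ 1) {N : Pol → Measure (Traj S A H)}
    (hN : N ∈ convexification (fun (M : MDP S A) (π : Pol) => M.trajLaw H s₁ π) models
      {g | ∃ f ∈ F, g = group H models opt φ ψ f}) :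
    ∃ f σ Q V, IsValuePair H Q V ∧ IsGreedy H (σ : Pol) Q V ∧ IsLinearPair H φ ψ f Q V ∧
      ∀ p : Pol, IsConsistent s₁ Q V p (N p) := by
  simp only [convexification, Set.mem_iUnion] at hN
  obtain ⟨_, ⟨f, _, rfl⟩, hN⟩ := hN
  obtain ⟨_, M₀, ⟨-, π₀, hM₀, -, hf₀⟩, -⟩ := convexHull_nonempty_iff.1 ⟨N, hN⟩
  have hQV := (hopt M₀ hM₀).isValuePair (hV M₀ hM₀)
  refine ⟨f, opt M₀, M₀.Q H (opt M₀), M₀.V H (opt M₀), hQV,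
    fun h hh s => (M₀.V_eq_Q_act hh _ s).symm, hf₀,
    convexHull_min ?_ (convex_isConsistent _ hQV) hN⟩
  rintro _ ⟨M, ⟨-, π, -, -, hf⟩, rfl⟩ p
  exact hf.isConsistent_trajLaw hf₀ hQV s₁ p

end Group

end ValueFunctions

end LinearQV

open LinearQV in
theorem theorem6_general {S A : Type*} [MeasurableSpace S] [MeasurableSpace A] (H d : ℕ) (s₁ : S)
    (Pol : Finset (Policy S A)) (models : Set (MDP S A)) (opt : MDP S A → Pol)
    (hopt : ∀ M ∈ models, M.IsOptimal H (opt M))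
    (hV : ∀ M ∈ models, ∀ h < H, ∀ s, M.V H (opt M) h s ≤ 1)
    (φ : ℕ → S → A → EuclideanSpace ℝ (Fin d)) (ψ : ℕ → S → EuclideanSpace ℝ (Fin d))
    (F : Set (EuclideanSpace ℝ (Fin d) × EuclideanSpace ℝ (Fin d))) (η : ℝ) (hη : 0 < η) :
    decKL (Pol := Pol) totalReward η
        (convexification (fun (M : MDP S A) (π : Pol) => M.trajLaw H s₁ π) models
          {g | ∃ f ∈ F, g = group H models opt φ ψ f})
      ≤ ((4 * η * d * H ^ 2 : ℝ) : EReal) := by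
  have hmix := fun N hN => exists_isConsistent_of_mem_convexification (φ := φ) (ψ := ψ) (F := F)
    (s₁ := s₁) (N := N) hopt hV hN
  refine decKL_le_of_posterior_sampling hη (L := H) (fun N hN π => ?_) (fun N hN π => ?_) ?_
  · obtain ⟨_, _, _, _, -, -, -, hN⟩ := hmix N hN
    exact (hN π).isProbabilityMeasure
  · obtain ⟨_, _, _, _, -, -, -, hN⟩ := hmix N hN
    exact (hN π).integral_totalReward_mem
  · intro Mbar hMbar ι _ ρ N hρ hN hkl
    choose f σ Q V hQV hσ hf hN using fun i => hmix (N i) (hN i)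
    refine ⟨σ, le_trans ?_ <| sum_suboptimality_sub_klDiv_le_four_mul hρ hQV hσ hf
      (fun g i => hN i (σ g)) (ν := fun g => Mbar (σ g)) (fun g i => hkl i (σ g)) hη⟩
    gcongr with g _ i
    exact offsetRegret_le_suboptimality_sub_klDiv (hQV i) (hN i) η (σ g)

open LinearQV in
theorem theorem6 {S A : Type*} [MeasurableSpace S] [MeasurableSpace A] (H d : ℕ) (s₁ : S)
    -- the finite policy class, the finite class of MDPs, and the optimal policies `π_M`
    (Pol : Finset (Policy S A)) (models : Set (MDP S A)) (hfin : models.Finite)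
    (hnorm : ∀ M ∈ models, M.Normalized H s₁)
    (opt : MDP S A → Pol) (hopt : ∀ M ∈ models, M.IsOptimal H (opt M))
    -- the features and the function class
    (φ : ℕ → S → A → EuclideanSpace ℝ (Fin d)) (ψ : ℕ → S → EuclideanSpace ℝ (Fin d))
    (F : Finset (EuclideanSpace ℝ (Fin d) × EuclideanSpace ℝ (Fin d)))
    (hlin : ∀ M ∈ models, ∃ f ∈ F, M.HasParam H (opt M) φ ψ f)
    (η : ℝ) (hη : 0 < η) :
    decKL (Pol := Pol) totalReward η
        (convexification (fun (M : MDP S A) (π : Pol) => M.trajLaw H s₁ π) models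
          {g | ∃ f ∈ F, g = group H models opt φ ψ f})
      ≤ ((4 * η * d * H ^ 2 : ℝ) : EReal) :=
  theorem6_general H d s₁ Pol models opt hopt
    (fun M hM h hh s => (M.V_eq_Q_act hh (opt M) s).trans_le ((hnorm M hM).2 _ h hh s _)) φ ψ F η hη
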